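/- Conventions. For a monoidal category $\mathcal C$: it is *left closed* if for every object $x$ the functor $-\otimes x$ has a right adjoint; it is *left rigid* if every object $x$ has a left dual, i.e. an object ${}^\vee x$ with morphisms $\mathrm{ev}\colon {}^\vee x\otimes x\to 1$ and $\mathrm{coev}\colon 1\to x\otimes {}^\vee x$ satisfying the snake identities. A *lax module endofunctor* of the regular module category $\mathcal C$ is a functor $F\colon\mathcal C\to\mathcal C$ with natural morphisms $x\otimes Fm\to F(x\otimes m)$ compatible with the associators and unitors; it is *strong* if all these morphisms are invertible. Let $B$ be a bialgebra over a field $\Bbbk$. Let ${}^B\mathbf{Vect}$ be the monoidal category of left $B$-comodules (tensor product over $\Bbbk$ with coaction $m\otimes n\mapsto m_{(-1)}n_{(-1)}\otimes m_{(0)}\otimes n_{(0)}$), and ${}^B\mathbf{vect}$ its full monoidal subcategory of finite-dimensional comodules. Let ${}^B_B\mathbf{Vect}^B$ be the category of Hopf trimodules: $B$-$B$-bicomodules $X$ with a left $B$-module structure $B\otimes X\to X$ that is a morphism of left and of right comodules (for the diagonal coactions on $B\otimes X$). The functor $B\otimes-\colon{}^B\mathbf{Vect}\to{}^B_B\mathbf{Vect}^B$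 sends $M$ to $B\otimes_\Bbbk M$ with left coaction $b\otimes m\mapsto b_{(1)}m_{(-1)}\otimes b_{(2)}\otimes m_{(0)}$, right coaction $b\otimes m\mapsto b_{(1)}\otimes m\otimes b_{(2)}$ and left action $a\otimes b\otimes m\mapsto ab\otimes m$, and sends $f$ to $\mathrm{id}_B\otimes f$. A *twisted antipode* of $B$ is a linear map $T\colon B\to B$ with $T(b_{(2)})\,b_{(1)}=\varepsilon(b)1=b_{(2)}\,T(b_{(1)})$ for all $b\in B$. **Theorem.** (1) Let $\mathcal C$ be a left closed monoidal category such that every lax module endofunctor of the regular module category $\mathcal C$ is strong. Then $\mathcal C$ is left rigid. (2) For a bialgebra $B$ over a field $\Bbbk$, the following are equivalent: (i) the functor $B\otimes-\colon{}^B\mathbf{Vect}\to{}^B_B\mathbf{Vect}^B$ is an equivalence of categories; (ii) $B$ has a twisted antipode; (iii) ${}^B\mathbf{vect}$ is left rigid; (iv) every lax module endofunctor of the regular module category ${}^B\mathbf{Vect}$ that is left exact (preserves finite limits) and finitary (preserves filtered colimits) is strong. -/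

import Mathlib

open CategoryTheory MonoidalCategory Limits
open scoped TensorProduct

universe u v₁ u₁

noncomputable section

namespace HopfTrimodule

/-! ### Left closed and left rigid monoidal categories, lax module endofunctors -/

section Monoidal

variable (C : Type u₁) [Category.{v₁} C] [MonoidalCategory C]

/-- A monoidal category is left closed if every functor `- ⊗ x` has a right adjoint `[x, -]`. -/
def IsLeftClosed : Prop :=
  ∀ x : C, (tensorRight x).IsLeftAdjoint

/-- A monoidal category is left rigid if every object `x` has a left dual, that is, an object `y`
with morphisms `ev : y ⊗ x ⟶ 𝟙_ C` and `coev : 𝟙_ C ⟶ x ⊗ y` satisfying the snake identities.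
(In Mathlib these are the data of `ExactPairing x y`, where `y` is called a right dual of `x`.) -/
def IsLeftRigid : Prop :=
  ∀ x : C, ∃ y : C, Nonempty (ExactPairing x y)

variable {C}

/-- A lax module endofunctor `F` of the left regular module category of `C` is strong if all its
structure morphisms `x ⊗ F m ⟶ F (x ⊗ m)` are invertible. -/
def IsStrong (F : C ⥤ C) [F.LaxLeftLinear C] : Prop :=
  ∀ x m : C, IsIso (Functor.LaxLeftLinear.μₗ F x m)

end Monoidal

/-! ### Coactions -/

section Coactions

variable {k : Type u} [Field k] {B : Type u} [Ring B] [Bialgebra k B]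
variable {M N P Q : Type u} [AddCommGroup M] [Module k M] [AddCommGroup N] [Module k N]
  [AddCommGroup P] [Module k P] [AddCommGroup Q] [Module k Q]

/-- `f : M → B ⊗ M` is a (coassociative and counital) left coaction of `B` on `M`. -/
structure IsLeftCoaction (f : M →ₗ[k] B ⊗[k] M) : Prop where
  coassoc : (TensorProduct.assoc k B B M).toLinearMap ∘ₗ
    (Coalgebra.comul (R := k) (A := B)).rTensor M ∘ₗ f = f.lTensor B ∘ₗ f
  counit : (Coalgebra.counit (R := k) (A := B)).rTensor M ∘ₗ f = TensorProduct.mk k k M 1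

/-- `f : M → M ⊗ B` is a (coassociative and counital) right coaction of `B` on `M`. -/
structure IsRightCoaction (f : M →ₗ[k] M ⊗[k] B) : Prop where
  coassoc : (TensorProduct.assoc k M B B).toLinearMap ∘ₗ f.rTensor B ∘ₗ f =
    (Coalgebra.comul (R := k) (A := B)).lTensor M ∘ₗ f
  counit : (Coalgebra.counit (R := k) (A := B)).lTensor M ∘ₗ f = (TensorProduct.mk k M k).flip 1

/-- `(b ⊗ m) ⊗ (c ⊗ n) ↦ bc ⊗ (m ⊗ n)`. -/
def mulLeft (k : Type u) [Field k] (B : Type u) [Ring B] [Bialgebra k B]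
    (M N : Type u) [AddCommGroup M] [Module k M] [AddCommGroup N] [Module k N] :
    (B ⊗[k] M) ⊗[k] (B ⊗[k] N) →ₗ[k] B ⊗[k] (M ⊗[k] N) :=
  (LinearMap.mul' k B).rTensor (M ⊗[k] N) ∘ₗ
    (TensorProduct.tensorTensorTensorComm k B M B N).toLinearMap

/-- `(m ⊗ b) ⊗ (n ⊗ c) ↦ (m ⊗ n) ⊗ bc`. -/
def mulRight (k : Type u) [Field k] (B : Type u) [Ring B] [Bialgebra k B]
    (M N : Type u) [AddCommGroup M] [Module k M] [AddCommGroup N] [Module k N] :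
    (M ⊗[k] B) ⊗[k] (N ⊗[k] B) →ₗ[k] (M ⊗[k] N) ⊗[k] B :=
  (LinearMap.mul' k B).lTensor (M ⊗[k] N) ∘ₗ
    (TensorProduct.tensorTensorTensorComm k M B N B).toLinearMap

/-- The diagonal left coaction `m ⊗ n ↦ m₍₋₁₎ n₍₋₁₎ ⊗ m₍₀₎ ⊗ n₍₀₎`. -/
def diagLeft (f : M →ₗ[k] B ⊗[k] M) (g : N →ₗ[k] B ⊗[k] N) :
    M ⊗[k] N →ₗ[k] B ⊗[k] (M ⊗[k] N) :=
  mulLeft k B M N ∘ₗ TensorProduct.map f g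

/-- The diagonal right coaction `m ⊗ n ↦ m₍₀₎ ⊗ n₍₀₎ ⊗ m₍₁₎ n₍₁₎`. -/
def diagRight (f : M →ₗ[k] M ⊗[k] B) (g : N →ₗ[k] N ⊗[k] B) :
    M ⊗[k] N →ₗ[k] (M ⊗[k] N) ⊗[k] B :=
  mulRight k B M N ∘ₗ TensorProduct.map f g

@[simp]
theorem mulLeft_tmul (b c : B) (m : M) (n : N) :
    mulLeft k B M N ((b ⊗ₜ m) ⊗ₜ (c ⊗ₜ n)) = (b * c) ⊗ₜ[k] (m ⊗ₜ[k] n) := by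
  simp [mulLeft]

@[simp]
theorem mulRight_tmul (b c : B) (m : M) (n : N) :
    mulRight k B M N ((m ⊗ₜ b) ⊗ₜ (n ⊗ₜ c)) = (m ⊗ₜ[k] n) ⊗ₜ[k] (b * c) := by
  simp [mulRight]

theorem diagLeft_tmul (f : M →ₗ[k] B ⊗[k] M) (g : N →ₗ[k] B ⊗[k] N) (m : M) (n : N) :
    diagLeft f g (m ⊗ₜ n) = mulLeft k B M N (f m ⊗ₜ g n) := rfl

theorem diagRight_tmul (f : M →ₗ[k] M ⊗[k] B) (g : N →ₗ[k] N ⊗[k] B) (m : M) (n : N) :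
    diagRight f g (m ⊗ₜ n) = mulRight k B M N (f m ⊗ₜ g n) := rfl

theorem isLeftCoaction_comul :
    IsLeftCoaction (Coalgebra.comul (R := k) (A := B)) :=
  ⟨Coalgebra.coassoc, Coalgebra.rTensor_counit_comp_comul⟩

/-- Naturality of `mulLeft`. -/
theorem mulLeft_natural (f : M →ₗ[k] P) (g : N →ₗ[k] Q) (p : B ⊗[k] M) (q : B ⊗[k] N) :
    mulLeft k B P Q (f.lTensor B p ⊗ₜ g.lTensor B q) =
      (TensorProduct.map f g).lTensor B (mulLeft k B M N (p ⊗ₜ q)) := by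
  induction p with
  | zero => simp
  | add x y hx hy => simp only [TensorProduct.add_tmul, map_add, hx, hy]
  | tmul b m =>
    induction q with
    | zero => simp
    | add x y hx hy => simp only [TensorProduct.tmul_add, map_add, hx, hy]
    | tmul c n => simp

theorem comul_mulLeft (p : B ⊗[k] M) (q : B ⊗[k] N) :
    TensorProduct.assoc k B B (M ⊗[k] N)
      ((Coalgebra.comul (R := k) (A := B)).rTensor (M ⊗[k] N) (mulLeft k B M N (p ⊗ₜ q))) =
    (mulLeft k B M N).lTensor B (mulLeft k B (B ⊗[k] M) (B ⊗[k] N)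
      (TensorProduct.assoc k B B M ((Coalgebra.comul (R := k) (A := B)).rTensor M p) ⊗ₜ
        TensorProduct.assoc k B B N ((Coalgebra.comul (R := k) (A := B)).rTensor N q))) := by
  induction p with
  | zero => simp
  | add x y hx hy => simp only [TensorProduct.add_tmul, map_add, hx, hy]
  | tmul b m =>
    induction q with
    | zero => simp
    | add x y hx hy => simp only [TensorProduct.tmul_add, map_add, hx, hy]
    | tmul c n =>
      simp only [mulLeft_tmul, LinearMap.rTensor_tmul, Bialgebra.comul_mul]
      generalize Coalgebra.comul (R := k) b = s
      generalize Coalgebra.comul (R := k) c = t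
      induction s with
      | zero => simp
      | add x y hx hy => simp only [add_mul, TensorProduct.add_tmul, map_add, hx, hy]
      | tmul b₁ b₂ =>
        induction t with
        | zero => simp
        | add x y hx hy =>
          simp only [mul_add, TensorProduct.add_tmul, TensorProduct.tmul_add, map_add, hx, hy]
        | tmul c₁ c₂ => simp

theorem counit_mulLeft (p : B ⊗[k] M) (q : B ⊗[k] N) :
    TensorProduct.lid k (M ⊗[k] N)
      ((Coalgebra.counit (R := k) (A := B)).rTensor (M ⊗[k] N) (mulLeft k B M N (p ⊗ₜ q))) =
    TensorProduct.lid k M ((Coalgebra.counit (R := k) (A := B)).rTensor M p) ⊗ₜ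
      TensorProduct.lid k N ((Coalgebra.counit (R := k) (A := B)).rTensor N q) := by
  induction p with
  | zero => simp
  | add x y hx hy => simp only [TensorProduct.add_tmul, map_add, hx, hy]
  | tmul b m =>
    induction q with
    | zero => simp
    | add x y hx hy => simp only [TensorProduct.tmul_add, map_add, hx, hy]
    | tmul c n =>
      simp only [mulLeft_tmul, LinearMap.rTensor_tmul, TensorProduct.lid_tmul, Bialgebra.counit_mul]
      rw [TensorProduct.smul_tmul_smul]

theorem IsLeftCoaction.diag {f : M →ₗ[k] B ⊗[k] M} {g : N →ₗ[k] B ⊗[k] N}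
    (hf : IsLeftCoaction f) (hg : IsLeftCoaction g) : IsLeftCoaction (diagLeft f g) where
  coassoc := by
    refine TensorProduct.ext' fun m n => ?_
    have h₁ := LinearMap.congr_fun hf.coassoc m
    have h₂ := LinearMap.congr_fun hg.coassoc n
    simp only [LinearMap.comp_apply, LinearEquiv.coe_coe] at h₁ h₂ ⊢
    rw [diagLeft_tmul, comul_mulLeft, h₁, h₂, mulLeft_natural, diagLeft, LinearMap.lTensor_comp]
    rfl
  counit := by
    refine TensorProduct.ext' fun m n => ?_
    have h₁ := LinearMap.congr_fun hf.counit m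
    have h₂ := LinearMap.congr_fun hg.counit n
    simp only [LinearMap.comp_apply] at h₁ h₂ ⊢
    apply (TensorProduct.lid k (M ⊗[k] N)).injective
    rw [diagLeft_tmul, counit_mulLeft, h₁, h₂]
    simp

end Coactions

/-! ### The monoidal category of left comodules -/

section Comodules

variable (k : Type u) [Field k] (B : Type u) [Ring B] [Bialgebra k B]

/-- A left `B`-comodule: a vector space with a left coaction of `B`. -/
structure LeftComod where
  V : ModuleCat.{u} k
  coact : V →ₗ[k] B ⊗[k] V
  isLeftCoaction : IsLeftCoaction coact

variable {k B}

namespace LeftComod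

/-- A morphism of left comodules: a linear map which commutes with the coactions. -/
@[ext]
structure Hom (M N : LeftComod k B) where
  toLin : M.V →ₗ[k] N.V
  comm : N.coact ∘ₗ toLin = toLin.lTensor B ∘ₗ M.coact

instance : Category (LeftComod k B) where
  Hom := Hom
  id M := ⟨LinearMap.id, by simp⟩
  comp f g := ⟨g.toLin ∘ₗ f.toLin, by
    rw [← LinearMap.comp_assoc, g.comm, LinearMap.comp_assoc, f.comm, ← LinearMap.comp_assoc,
      ← LinearMap.lTensor_comp]⟩

@[ext]
theorem hom_ext {M N : LeftComod k B} {f g : M ⟶ N} (h : f.toLin = g.toLin) : f = g :=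
  Hom.ext h

@[simp]
theorem id_toLin (M : LeftComod k B) : Hom.toLin (𝟙 M) = LinearMap.id := rfl

@[simp]
theorem comp_toLin {M N P : LeftComod k B} (f : M ⟶ N) (g : N ⟶ P) :
    (f ≫ g).toLin = g.toLin ∘ₗ f.toLin := rfl

variable (k B) in
/-- The functor which forgets the coaction. -/
@[simps]
def forget : LeftComod k B ⥤ ModuleCat.{u} k where
  obj M := M.V
  map f := ModuleCat.ofHom f.toLin

instance : (forget k B).Faithful where
  map_injective h := hom_ext (congrArg ModuleCat.Hom.hom h)

/-- A linear isomorphism which commutes with the coactions is an isomorphism of comodules. -/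
def mkIso {M N : LeftComod k B} (e : M.V ≃ₗ[k] N.V)
    (h : N.coact ∘ₗ e.toLinearMap = e.toLinearMap.lTensor B ∘ₗ M.coact) : M ≅ N where
  hom := ⟨e.toLinearMap, h⟩
  inv := ⟨e.symm.toLinearMap, by
    have h' : (e.symm.toLinearMap.lTensor B) ∘ₗ (e.toLinearMap.lTensor B) = LinearMap.id := by
      rw [← LinearMap.lTensor_comp]; simp
    calc M.coact ∘ₗ e.symm.toLinearMap
        = ((e.symm.toLinearMap.lTensor B) ∘ₗ (e.toLinearMap.lTensor B)) ∘ₗ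
            M.coact ∘ₗ e.symm.toLinearMap := by rw [h', LinearMap.id_comp]
      _ = (e.symm.toLinearMap.lTensor B) ∘ₗ ((e.toLinearMap.lTensor B) ∘ₗ M.coact) ∘ₗ
            e.symm.toLinearMap := by simp only [LinearMap.comp_assoc]
      _ = _ := by rw [← h, LinearMap.comp_assoc, LinearEquiv.comp_symm, LinearMap.comp_id]⟩
  hom_inv_id := by ext1; simp
  inv_hom_id := by ext1; simp

/-- The tensor product of comodules: the tensor product over `k` with the diagonal coaction. -/
def tensorObj (M N : LeftComod k B) : LeftComod k B where
  V := ModuleCat.of k (M.V ⊗[k] N.V)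
  coact := diagLeft M.coact N.coact
  isLeftCoaction := M.isLeftCoaction.diag N.isLeftCoaction

/-- The trivial comodule: `k` with coaction `1 ↦ 1 ⊗ 1`. -/
def tensorUnit : LeftComod k B where
  V := ModuleCat.of k k
  coact := TensorProduct.mk k B k 1
  isLeftCoaction := ⟨by ext; simp [Algebra.TensorProduct.one_def], by ext; simp⟩

/-- The tensor product of morphisms is the tensor product of linear maps. -/
def tensorHom {M N P Q : LeftComod k B} (f : M ⟶ N) (g : P ⟶ Q) :
    tensorObj M P ⟶ tensorObj N Q where
  toLin := TensorProduct.map f.toLin g.toLin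
  comm := by
    refine TensorProduct.ext' fun m p => ?_
    have h₁ := LinearMap.congr_fun f.comm m
    have h₂ := LinearMap.congr_fun g.comm p
    simp only [LinearMap.comp_apply] at h₁ h₂
    change diagLeft N.coact Q.coact (f.toLin m ⊗ₜ g.toLin p) =
      (TensorProduct.map f.toLin g.toLin).lTensor B (diagLeft M.coact P.coact (m ⊗ₜ p))
    rw [diagLeft_tmul, diagLeft_tmul, h₁, h₂, mulLeft_natural]

theorem assoc_mulLeft {M N P : Type u} [AddCommGroup M] [Module k M] [AddCommGroup N] [Module k N]
    [AddCommGroup P] [Module k P] (x : B ⊗[k] M) (y : B ⊗[k] N) (z : B ⊗[k] P) :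
    mulLeft k B M (N ⊗[k] P) (x ⊗ₜ mulLeft k B N P (y ⊗ₜ z)) =
      (TensorProduct.assoc k M N P).toLinearMap.lTensor B
        (mulLeft k B (M ⊗[k] N) P (mulLeft k B M N (x ⊗ₜ y) ⊗ₜ z)) := by
  induction x with
  | zero => simp
  | add x x' hx hx' => simp only [TensorProduct.add_tmul, map_add, hx, hx']
  | tmul b m =>
    induction y with
    | zero => simp
    | add y y' hy hy' =>
      simp only [TensorProduct.add_tmul, TensorProduct.tmul_add, map_add, hy, hy']
    | tmul c n =>
      induction z with
      | zero => simp
      | add z z' hz hz' => simp only [TensorProduct.tmul_add, map_add, hz, hz']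
      | tmul d p => simp [mul_assoc]

/-- The associator is that of vector spaces. -/
def associator (M N P : LeftComod k B) :
    tensorObj (tensorObj M N) P ≅ tensorObj M (tensorObj N P) :=
  mkIso (TensorProduct.assoc k M.V N.V P.V) (by
    refine TensorProduct.ext_threefold fun m n p => ?_
    exact assoc_mulLeft (M.coact m) (N.coact n) (P.coact p))

theorem lid_mulLeft {M : Type u} [AddCommGroup M] [Module k M] (c : k) (x : B ⊗[k] M) :
    c • x = (TensorProduct.lid k M).toLinearMap.lTensor B
      (mulLeft k B k M (((1 : B) ⊗ₜ c) ⊗ₜ x)) := by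
  induction x with
  | zero => simp
  | add x y hx hy => simp only [TensorProduct.tmul_add, map_add, smul_add, hx, hy]
  | tmul b n => simp

theorem rid_mulLeft {M : Type u} [AddCommGroup M] [Module k M] (c : k) (x : B ⊗[k] M) :
    c • x = (TensorProduct.rid k M).toLinearMap.lTensor B
      (mulLeft k B M k (x ⊗ₜ ((1 : B) ⊗ₜ c))) := by
  induction x with
  | zero => simp
  | add x y hx hy => simp only [TensorProduct.add_tmul, map_add, smul_add, hx, hy]
  | tmul b n => simp

/-- The left unitor is that of vector spaces. -/
def leftUnitor (M : LeftComod k B) : tensorObj tensorUnit M ≅ M :=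
  mkIso (TensorProduct.lid k M.V) (by
    refine TensorProduct.ext' fun c m => ?_
    exact (M.coact.map_smul c m).trans (lid_mulLeft (k := k) c (M.coact m)))

/-- The right unitor is that of vector spaces. -/
def rightUnitor (M : LeftComod k B) : tensorObj M tensorUnit ≅ M :=
  mkIso (TensorProduct.rid k M.V) (by
    refine TensorProduct.ext' fun m c => ?_
    exact (M.coact.map_smul c m).trans (rid_mulLeft (k := k) c (M.coact m)))

instance : MonoidalCategoryStruct (LeftComod k B) where
  tensorObj := tensorObj
  whiskerLeft M _ _ f := tensorHom (𝟙 M) f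
  whiskerRight f N := tensorHom f (𝟙 N)
  tensorHom f g := tensorHom f g
  tensorUnit := tensorUnit
  associator := associator
  leftUnitor := leftUnitor
  rightUnitor := rightUnitor

/-- The monoidal category of left `B`-comodules; all coherence is inherited from vector spaces. -/
instance : MonoidalCategory (LeftComod k B) :=
  Monoidal.induced (forget k B)
    { μIso := fun _ _ => Iso.refl _
      εIso := Iso.refl _
      whiskerLeft_eq := fun _ _ _ _ => ModuleCat.MonoidalCategory.tensor_ext fun _ _ => rfl
      whiskerRight_eq := fun _ _ => ModuleCat.MonoidalCategory.tensor_ext fun _ _ => rfl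
      tensorHom_eq := fun _ _ => ModuleCat.MonoidalCategory.tensor_ext fun _ _ => rfl
      associator_eq := fun _ _ _ => ModuleCat.MonoidalCategory.tensor_ext₃' fun _ _ _ => rfl
      leftUnitor_eq := fun _ => ModuleCat.MonoidalCategory.tensor_ext fun _ _ => rfl
      rightUnitor_eq := fun _ => ModuleCat.MonoidalCategory.tensor_ext fun _ _ => rfl }

variable (k B) in
/-- The property of being finite-dimensional. -/
def isFinite : ObjectProperty (LeftComod k B) := fun M => Module.Finite k M.V

instance : (isFinite k B).IsMonoidal where
  prop_unit := inferInstanceAs (Module.Finite k k)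
  prop_tensor M N hM hN := by
    have : Module.Finite k M.V := hM
    have : Module.Finite k N.V := hN
    exact inferInstanceAs (Module.Finite k (M.V ⊗[k] N.V))

end LeftComod

variable (k B)

/-- The monoidal category of finite-dimensional left `B`-comodules. -/
abbrev FinLeftComod := (LeftComod.isFinite k B).FullSubcategory

/-! ### Hopf trimodules -/

/-- A Hopf trimodule: a `B`-`B`-bicomodule `V` with a left action of `B` which is a morphism of left
and of right comodules, where `B ⊗ V` has the diagonal coactions. -/
structure Trimod where
  V : ModuleCat.{u} k
  lcoact : V →ₗ[k] B ⊗[k] V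
  rcoact : V →ₗ[k] V ⊗[k] B
  act : B ⊗[k] V →ₗ[k] V
  isLeftCoaction : IsLeftCoaction lcoact
  isRightCoaction : IsRightCoaction rcoact
  bicomodule : rcoact.lTensor B ∘ₗ lcoact =
    (TensorProduct.assoc k B V B).toLinearMap ∘ₗ lcoact.rTensor B ∘ₗ rcoact
  one_act : ∀ x : V, act (1 ⊗ₜ x) = x
  mul_act : ∀ (a b : B) (x : V), act ((a * b) ⊗ₜ x) = act (a ⊗ₜ act (b ⊗ₜ x))
  lcoact_act : lcoact ∘ₗ act = act.lTensor B ∘ₗ diagLeft Coalgebra.comul lcoact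
  rcoact_act : rcoact ∘ₗ act = act.rTensor B ∘ₗ diagRight Coalgebra.comul rcoact

variable {k B}

namespace Trimod

/-- A morphism of Hopf trimodules: a linear map which commutes with both coactions and the
action. -/
@[ext]
structure Hom (X Y : Trimod k B) where
  toLin : X.V →ₗ[k] Y.V
  lcomm : Y.lcoact ∘ₗ toLin = toLin.lTensor B ∘ₗ X.lcoact
  rcomm : Y.rcoact ∘ₗ toLin = toLin.rTensor B ∘ₗ X.rcoact
  act_comm : toLin ∘ₗ X.act = Y.act ∘ₗ toLin.lTensor B

instance : Category (Trimod k B) where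
  Hom := Hom
  id X := ⟨LinearMap.id, by simp, by simp, by simp⟩
  comp f g := ⟨g.toLin ∘ₗ f.toLin,
    by rw [← LinearMap.comp_assoc, g.lcomm, LinearMap.comp_assoc, f.lcomm, ← LinearMap.comp_assoc,
      ← LinearMap.lTensor_comp],
    by rw [← LinearMap.comp_assoc, g.rcomm, LinearMap.comp_assoc, f.rcomm, ← LinearMap.comp_assoc,
      ← LinearMap.rTensor_comp],
    by rw [LinearMap.comp_assoc, f.act_comm, ← LinearMap.comp_assoc, g.act_comm,
      LinearMap.comp_assoc, ← LinearMap.lTensor_comp]⟩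

@[ext]
theorem hom_ext {X Y : Trimod k B} {f g : X ⟶ Y} (h : f.toLin = g.toLin) : f = g :=
  Hom.ext h

@[simp]
theorem id_toLin (X : Trimod k B) : Hom.toLin (𝟙 X) = LinearMap.id := rfl

@[simp]
theorem comp_toLin {X Y Z : Trimod k B} (f : X ⟶ Y) (g : Y ⟶ Z) :
    (f ≫ g).toLin = g.toLin ∘ₗ f.toLin := rfl

section Free

variable (B) (M : Type u) [AddCommGroup M] [Module k M]

/-- The right coaction `b ⊗ m ↦ b₍₁₎ ⊗ m ⊗ b₍₂₎` on `B ⊗ M`. -/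
def freeRcoact : B ⊗[k] M →ₗ[k] (B ⊗[k] M) ⊗[k] B :=
  (TensorProduct.rightComm k B B M).toLinearMap ∘ₗ Coalgebra.comul.rTensor M

/-- The left action `a ⊗ b ⊗ m ↦ ab ⊗ m` on `B ⊗ M`. -/
def freeAct : B ⊗[k] (B ⊗[k] M) →ₗ[k] B ⊗[k] M :=
  (LinearMap.mul' k B).rTensor M ∘ₗ (TensorProduct.assoc k B B M).symm.toLinearMap

variable {B M}

theorem freeRcoact_tmul (b : B) (m : M) :
    freeRcoact B M (b ⊗ₜ[k] m) =
      TensorProduct.rightComm k B B M (Coalgebra.comul (R := k) b ⊗ₜ m) := rfl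

@[simp]
theorem freeAct_tmul (a b : B) (m : M) :
    freeAct B M (a ⊗ₜ[k] (b ⊗ₜ[k] m)) = (a * b) ⊗ₜ[k] m := rfl

theorem freeRcoact_coassoc_aux (s : B ⊗[k] B) (m : M) :
    TensorProduct.assoc k (B ⊗[k] M) B B ((freeRcoact B M).rTensor B
      (TensorProduct.rightComm k B B M (s ⊗ₜ m))) =
    ((TensorProduct.mk k B M).flip m).rTensor (B ⊗[k] B)
      (TensorProduct.assoc k B B B ((Coalgebra.comul (R := k) (A := B)).rTensor B s)) := by
  induction s with
  | zero => simp
  | add x y hx hy => simp only [TensorProduct.add_tmul, map_add, hx, hy]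
  | tmul a c =>
    simp only [TensorProduct.rightComm_tmul, LinearMap.rTensor_tmul, freeRcoact_tmul]
    generalize Coalgebra.comul (R := k) a = t
    induction t with
    | zero => simp
    | add x y hx hy => simp only [TensorProduct.add_tmul, map_add, hx, hy]
    | tmul p q => simp

theorem freeRcoact_coassoc_aux' (s : B ⊗[k] B) (m : M) :
    (Coalgebra.comul (R := k) (A := B)).lTensor (B ⊗[k] M)
      (TensorProduct.rightComm k B B M (s ⊗ₜ m)) =
    ((TensorProduct.mk k B M).flip m).rTensor (B ⊗[k] B)
      ((Coalgebra.comul (R := k) (A := B)).lTensor B s) := by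
  induction s with
  | zero => simp
  | add x y hx hy => simp only [TensorProduct.add_tmul, map_add, hx, hy]
  | tmul a c => simp

theorem freeRcoact_counit_aux (s : B ⊗[k] B) (m : M) :
    (Coalgebra.counit (R := k) (A := B)).lTensor (B ⊗[k] M)
      (TensorProduct.rightComm k B B M (s ⊗ₜ m)) =
    ((TensorProduct.mk k B M).flip m).rTensor k
      ((Coalgebra.counit (R := k) (A := B)).lTensor B s) := by
  induction s with
  | zero => simp
  | add x y hx hy => simp only [TensorProduct.add_tmul, map_add, hx, hy]
  | tmul a c => simp

theorem isRightCoaction_freeRcoact : IsRightCoaction (freeRcoact (k := k) B M) where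
  coassoc := by
    refine TensorProduct.ext' fun b m => ?_
    simp only [LinearMap.comp_apply, LinearEquiv.coe_coe]
    rw [freeRcoact_tmul, freeRcoact_coassoc_aux, freeRcoact_coassoc_aux', Coalgebra.coassoc_apply]
  counit := by
    refine TensorProduct.ext' fun b m => ?_
    simp only [LinearMap.comp_apply]
    rw [freeRcoact_tmul, freeRcoact_counit_aux, Coalgebra.lTensor_counit_comul]
    simp

theorem free_bicomodule_aux (f : M →ₗ[k] B ⊗[k] M) (s : B ⊗[k] B) (m : M) :
    TensorProduct.assoc k B (B ⊗[k] M) B ((diagLeft Coalgebra.comul f).rTensor B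
      (TensorProduct.rightComm k B B M (s ⊗ₜ m))) =
    (TensorProduct.rightComm k B B M).toLinearMap.lTensor B (mulLeft k B (B ⊗[k] B) M
      (TensorProduct.assoc k B B B ((Coalgebra.comul (R := k) (A := B)).rTensor B s) ⊗ₜ f m)) := by
  induction s with
  | zero => simp
  | add x y hx hy => simp only [TensorProduct.add_tmul, map_add, hx, hy]
  | tmul a c =>
    simp only [TensorProduct.rightComm_tmul, LinearMap.rTensor_tmul, diagLeft_tmul]
    generalize Coalgebra.comul (R := k) a = t
    generalize f m = y
    induction t with
    | zero => simp
    | add x y hx hy => simp only [TensorProduct.add_tmul, map_add, hx, hy]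
    | tmul p q =>
      induction y with
      | zero => simp
      | add x y hx hy => simp only [TensorProduct.add_tmul, TensorProduct.tmul_add, map_add, hx, hy]
      | tmul d n => simp

theorem free_bicomodule (f : M →ₗ[k] B ⊗[k] M) :
    (freeRcoact B M).lTensor B ∘ₗ diagLeft Coalgebra.comul f =
      (TensorProduct.assoc k B (B ⊗[k] M) B).toLinearMap ∘ₗ
        (diagLeft Coalgebra.comul f).rTensor B ∘ₗ freeRcoact B M := by
  refine TensorProduct.ext' fun b m => ?_
  simp only [LinearMap.comp_apply, LinearEquiv.coe_coe]
  rw [freeRcoact_tmul, free_bicomodule_aux, Coalgebra.coassoc_apply, diagLeft_tmul, freeRcoact,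
    LinearMap.lTensor_comp, LinearMap.comp_apply]
  have h := mulLeft_natural (Coalgebra.comul (R := k) (A := B)) (LinearMap.id (R := k) (M := M))
    (Coalgebra.comul (R := k) b) (f m)
  rw [LinearMap.lTensor_id, LinearMap.id_apply] at h
  rw [h]
  rfl

theorem free_one_act (x : B ⊗[k] M) : freeAct B M (1 ⊗ₜ x) = x := by
  induction x with
  | zero => simp
  | add x y hx hy => simp only [TensorProduct.tmul_add, map_add, hx, hy]
  | tmul b m => simp

theorem free_mul_act (a b : B) (x : B ⊗[k] M) :
    freeAct B M ((a * b) ⊗ₜ[k] x) = freeAct B M (a ⊗ₜ freeAct B M (b ⊗ₜ x)) := by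
  induction x with
  | zero => simp
  | add x y hx hy => simp only [TensorProduct.tmul_add, map_add, hx, hy]
  | tmul b m => simp [mul_assoc]

theorem free_lcoact_act_aux (s t : B ⊗[k] B) (y : B ⊗[k] M) :
    mulLeft k B B M ((s * t) ⊗ₜ y) =
      (freeAct B M).lTensor B (mulLeft k B B (B ⊗[k] M) (s ⊗ₜ mulLeft k B B M (t ⊗ₜ y))) := by
  induction s with
  | zero => simp
  | add x y hx hy => simp only [add_mul, TensorProduct.add_tmul, map_add, hx, hy]
  | tmul a b =>
    induction t with
    | zero => simp
    | add x y hx hy =>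
      simp only [mul_add, TensorProduct.add_tmul, TensorProduct.tmul_add, map_add, hx, hy]
    | tmul c d =>
      induction y with
      | zero => simp
      | add x y hx hy => simp only [TensorProduct.tmul_add, map_add, hx, hy]
      | tmul e n => simp [mul_assoc]

theorem free_lcoact_act (f : M →ₗ[k] B ⊗[k] M) :
    diagLeft Coalgebra.comul f ∘ₗ freeAct B M =
      (freeAct B M).lTensor B ∘ₗ diagLeft Coalgebra.comul (diagLeft Coalgebra.comul f) := by
  refine TensorProduct.ext_threefold' fun a b m => ?_
  simp only [LinearMap.comp_apply, freeAct_tmul, diagLeft_tmul, Bialgebra.comul_mul]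
  exact free_lcoact_act_aux _ _ _

theorem free_rcoact_act_aux (s t : B ⊗[k] B) (m : M) :
    TensorProduct.rightComm k B B M ((s * t) ⊗ₜ m) =
      (freeAct B M).rTensor B (mulRight k B B (B ⊗[k] M)
        (s ⊗ₜ TensorProduct.rightComm k B B M (t ⊗ₜ m))) := by
  induction s with
  | zero => simp
  | add x y hx hy => simp only [add_mul, TensorProduct.add_tmul, map_add, hx, hy]
  | tmul a b =>
    induction t with
    | zero => simp
    | add x y hx hy =>
      simp only [mul_add, TensorProduct.add_tmul, TensorProduct.tmul_add, map_add, hx, hy]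
    | tmul c d => simp

theorem free_rcoact_act :
    freeRcoact B M ∘ₗ freeAct B M =
      (freeAct B M).rTensor B ∘ₗ diagRight Coalgebra.comul (freeRcoact (k := k) B M) := by
  refine TensorProduct.ext_threefold' fun a b m => ?_
  simp only [LinearMap.comp_apply, freeAct_tmul, diagRight_tmul, freeRcoact_tmul,
    Bialgebra.comul_mul]
  exact free_rcoact_act_aux _ _ _

end Free

/-- The Hopf trimodule `B ⊗ M` of a left comodule `M`, with left coaction
`b ⊗ m ↦ b₍₁₎ m₍₋₁₎ ⊗ b₍₂₎ ⊗ m₍₀₎`, right coaction `b ⊗ m ↦ b₍₁₎ ⊗ m ⊗ b₍₂₎`,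
and left action `a ⊗ b ⊗ m ↦ ab ⊗ m`. -/
def free (M : LeftComod k B) : Trimod k B where
  V := ModuleCat.of k (B ⊗[k] M.V)
  lcoact := diagLeft Coalgebra.comul M.coact
  rcoact := freeRcoact B M.V
  act := freeAct B M.V
  isLeftCoaction := isLeftCoaction_comul.diag M.isLeftCoaction
  isRightCoaction := isRightCoaction_freeRcoact
  bicomodule := free_bicomodule M.coact
  one_act := free_one_act
  mul_act := free_mul_act
  lcoact_act := free_lcoact_act M.coact
  rcoact_act := free_rcoact_act

theorem rightComm_natural {M N : Type u} [AddCommGroup M] [Module k M] [AddCommGroup N]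
    [Module k N] (f : M →ₗ[k] N) (s : B ⊗[k] B) (m : M) :
    TensorProduct.rightComm k B B N (s ⊗ₜ f m) =
      (f.lTensor B).rTensor B (TensorProduct.rightComm k B B M (s ⊗ₜ m)) := by
  induction s with
  | zero => simp
  | add x y hx hy => simp only [TensorProduct.add_tmul, map_add, hx, hy]
  | tmul a b => simp

/-- The morphism `id ⊗ f : B ⊗ M ⟶ B ⊗ N` of Hopf trimodules. -/
def freeMap {M N : LeftComod k B} (f : M ⟶ N) : free M ⟶ free N where
  toLin := f.toLin.lTensor B
  lcomm := by
    refine TensorProduct.ext' fun b m => ?_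
    have h₁ := LinearMap.congr_fun f.comm m
    simp only [LinearMap.comp_apply] at h₁
    change diagLeft Coalgebra.comul N.coact (b ⊗ₜ f.toLin m) =
      (f.toLin.lTensor B).lTensor B (diagLeft Coalgebra.comul M.coact (b ⊗ₜ m))
    have h := mulLeft_natural (LinearMap.id (R := k) (M := B)) f.toLin
      (Coalgebra.comul (R := k) b) (M.coact m)
    rw [LinearMap.lTensor_id, LinearMap.id_apply] at h
    rw [diagLeft_tmul, diagLeft_tmul, h₁, h]
    rfl
  rcomm := by
    refine TensorProduct.ext' fun b m => ?_
    exact rightComm_natural f.toLin (Coalgebra.comul (R := k) b) m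
  act_comm := TensorProduct.ext_threefold' fun _ _ _ => rfl

end Trimod

variable (k B) in
/-- The functor `B ⊗ -` from left comodules to Hopf trimodules. -/
def freeTrimod : LeftComod k B ⥤ Trimod k B where
  obj := Trimod.free
  map := Trimod.freeMap
  map_id M := Trimod.hom_ext (LinearMap.lTensor_id B M.V)
  map_comp f g := Trimod.hom_ext (LinearMap.lTensor_comp B g.toLin f.toLin)

variable (k B) in
/-- A twisted antipode is a linear map `T : B → B` with
`T(b₍₂₎) b₍₁₎ = ε(b) 1 = b₍₂₎ T(b₍₁₎)` for all `b`. -/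
def HasTwistedAntipode : Prop :=
  ∃ T : B →ₗ[k] B,
    (∀ b : B, LinearMap.mul' k B (T.rTensor B
      (TensorProduct.comm k B B (Coalgebra.comul b))) = algebraMap k B (Coalgebra.counit b)) ∧
    (∀ b : B, LinearMap.mul' k B (T.lTensor B
      (TensorProduct.comm k B B (Coalgebra.comul b))) = algebraMap k B (Coalgebra.counit b))

end Comodules

end HopfTrimodule

end

/-! Part (1). The internal hom `[x, -]`, right adjoint to `- ⊗ x`, is a lax module functor through
`c ⊗ [x, d] ⟶ [x, c ⊗ d]`. If this is invertible at `c = x`, `d = 1`, then `x ⊗ [x, 1] ≅ [x, x]`,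
and the identity of `x` on the right-hand side becomes a coevaluation on the left. So `[x, 1]` is a
left dual of `x` (`nonempty_exactPairing_of_isIso`).

Part (2). The pivot is the Galois map `a ⊗ b ↦ a₍₁₎ b ⊗ a₍₂₎` of `B ⊗ B`. If it is bijective, its
inverse sends `1 ⊗ b` to `b₍₂₎ ⊗ T(b₍₁₎)` for a twisted antipode `T`
(`hasTwistedAntipode_of_bijective`). Conditions (i) and (iv) each produce this map. For (i), take
the Hopf trimodule `B ⊗ B` with diagonal action. Its right coinvariants are `B ⊗ 1`, and an
isomorphism from a free trimodule onto it has to be the Galois map up to a bijection on coinvariants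
(`bijective_galois_of_iso`). For (iv), take the endofunctor "cofree comodule on the underlying
space". It is left exact and finitary, and its structure morphism at the regular and the trivial
comodule is the Galois map (`bijective_galois_of_isStrong`).

Conversely, let `T` be a twisted antipode. For (i), `x ↦ T(x₍₁₎) x₍₀₎` projects a Hopf trimodule
onto its right coinvariants, and this makes the trimodule free on them (`Trimod.exists_iso_free`);
full faithfulness holds over every bialgebra. For (iii), if `c` is the coefficient matrix of a
finite-dimensional comodule, the axioms of `T` say that the transpose of `T(c)` is inverse to the
transpose of `c`. Such an inverse is again a comatrix (`IsComatrix.of_inverse`) and defines the dual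
comodule. The same matrix argument shows that `T` reverses comultiplication.

Finally (iii) implies (iv). A lax structure morphism is invertible at every object with a left dual
(`isIso_of_exactPairing`). Every comodule is the filtered colimit of its finite-dimensional
subcomodules, and a finitary functor carries invertibility over to the colimit. -/

noncomputable section

namespace HopfTrimodule

/-! ### Internal homs, duals and lax module functors -/

section Monoidal

variable {C : Type u₁} [Category.{v₁} C] [MonoidalCategory C]

section InternalHom

variable {x : C} {G : C ⥤ C} (adj : tensorRight x ⊣ G)

/-- The evaluation `[x, d] ⊗ x ⟶ d` of the internal hom `[x, -]`, written `G`. -/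
def evalHom (d : C) : G.obj d ⊗ x ⟶ d := adj.counit.app d

/-- The transpose `c ⟶ [x, d]` of a morphism `c ⊗ x ⟶ d`. -/
def curryHom {c d : C} (f : c ⊗ x ⟶ d) : c ⟶ G.obj d := adj.homEquiv c d f

theorem curryHom_evalHom {c d : C} (f : c ⊗ x ⟶ d) :
    curryHom adj f ▷ x ≫ evalHom adj d = f :=
  (adj.homEquiv_counit (X := c) (Y := d) (g := curryHom adj f)).symm.trans
    ((adj.homEquiv c d).symm_apply_apply f)

/-- Transposition is injective. All identities between morphisms into an internal hom are checked
this way. -/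
theorem evalHom_ext {c d : C} {f g : c ⟶ G.obj d}
    (h : f ▷ x ≫ evalHom adj d = g ▷ x ≫ evalHom adj d) : f = g := by
  apply (adj.homEquiv c d).symm.injective
  rw [adj.homEquiv_counit, adj.homEquiv_counit]
  exact h

theorem map_evalHom {c d : C} (f : c ⟶ d) :
    G.map f ▷ x ≫ evalHom adj d = evalHom adj c ≫ f :=
  adj.counit.naturality f

/-- The structure morphism `c ⊗ [x, d] ⟶ [x, c ⊗ d]` of the internal hom. -/
def internalHomLax (c d : C) : c ⊗ G.obj d ⟶ G.obj (c ⊗ d) :=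
  curryHom adj ((α_ c (G.obj d) x).hom ≫ c ◁ evalHom adj d)

theorem internalHomLax_evalHom (c d : C) :
    internalHomLax adj c d ▷ x ≫ evalHom adj (c ⊗ d) =
      (α_ c (G.obj d) x).hom ≫ c ◁ evalHom adj d :=
  curryHom_evalHom adj _

theorem internalHomLax_evalHom_assoc (c d : C) {z : C} (h : c ⊗ d ⟶ z) :
    internalHomLax adj c d ▷ x ≫ evalHom adj (c ⊗ d) ≫ h =
      (α_ c (G.obj d) x).hom ≫ c ◁ evalHom adj d ≫ h := by
  rw [← Category.assoc, internalHomLax_evalHom, Category.assoc]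

/-- The internal hom `[x, -]` is a lax module endofunctor. -/
@[reducible]
def internalHomLaxLeftLinear : G.LaxLeftLinear C where
  μₗ c d := internalHomLax adj c d
  μₗ_naturality_left {c c'} f d := by
    change f ▷ G.obj d ≫ internalHomLax adj c' d = internalHomLax adj c d ≫ G.map (f ▷ d)
    apply evalHom_ext adj
    simp only [comp_whiskerRight, Category.assoc, map_evalHom, internalHomLax_evalHom,
      internalHomLax_evalHom_assoc]
    simp [whisker_exchange]
  μₗ_naturality_right c {d d'} f := by
    change c ◁ G.map f ≫ internalHomLax adj c d' = internalHomLax adj c d ≫ G.map (c ◁ f)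
    apply evalHom_ext adj
    simp only [comp_whiskerRight, Category.assoc, map_evalHom, internalHomLax_evalHom,
      internalHomLax_evalHom_assoc]
    simp only [whisker_assoc, Category.assoc, Iso.inv_hom_id_assoc, ← whiskerLeft_comp,
      map_evalHom]
  μₗ_associativity c c' d := by
    change internalHomLax adj (c ⊗ c') d ≫ G.map (α_ c c' d).hom =
      (α_ c c' (G.obj d)).hom ≫ c ◁ internalHomLax adj c' d ≫ internalHomLax adj c (c' ⊗ d)
    apply evalHom_ext adj
    simp only [comp_whiskerRight, Category.assoc, map_evalHom, internalHomLax_evalHom,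
      internalHomLax_evalHom_assoc]
    simp only [whisker_assoc, Category.assoc, Iso.inv_hom_id_assoc, ← whiskerLeft_comp,
      internalHomLax_evalHom]
    simp
  μₗ_unitality d := by
    change (λ_ (G.obj d)).hom = internalHomLax adj (𝟙_ C) d ≫ G.map (λ_ d).hom
    apply evalHom_ext adj
    simp only [comp_whiskerRight, Category.assoc, map_evalHom,
      internalHomLax_evalHom_assoc]
    simp

/-- The evaluation of `[x, 1]` serves as the evaluation of the dual; invertibility is needed only to
obtain a coevaluation. -/
theorem nonempty_exactPairing_of_isIso (h : IsIso (internalHomLax adj x (𝟙_ C))) :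
    Nonempty (ExactPairing x (G.obj (𝟙_ C))) := by
  let y : C := G.obj (𝟙_ C)
  let ev : y ⊗ x ⟶ 𝟙_ C := evalHom adj (𝟙_ C)
  -- The name of the identity of `x`, a point of `[x, x ⊗ 1]`, pulled back along the inverted
  -- structure morphism.
  let coev : 𝟙_ C ⟶ x ⊗ y :=
    curryHom adj ((λ_ x).hom ≫ (ρ_ x).inv) ≫ inv (internalHomLax adj x (𝟙_ C))
  have h₁ : coev ▷ x ≫ (α_ x y x).hom ≫ x ◁ ev = (λ_ x).hom ≫ (ρ_ x).inv := by
    have e := internalHomLax_evalHom adj x (𝟙_ C)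
    calc coev ▷ x ≫ (α_ x y x).hom ≫ x ◁ ev
        = coev ▷ x ≫ internalHomLax adj x (𝟙_ C) ▷ x ≫ evalHom adj (x ⊗ 𝟙_ C) := by rw [e]
      _ = curryHom adj ((λ_ x).hom ≫ (ρ_ x).inv) ▷ x ≫ evalHom adj (x ⊗ 𝟙_ C) := by
          rw [← comp_whiskerRight_assoc]; simp [coev]
      _ = _ := curryHom_evalHom adj _
  refine ⟨⟨coev, ev, ?_, h₁⟩⟩
  -- The second snake is an equation of maps into `[x, 1]`, so it may be tested under evaluation.
  -- There the interchange law reduces it to the first snake.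
  rw [← cancel_mono (λ_ y).hom]
  apply evalHom_ext adj
  change _ ▷ x ≫ ev = _ ▷ x ≫ ev
  calc ((y ◁ coev ≫ (α_ y x y).inv ≫ ev ▷ y) ≫ (λ_ y).hom) ▷ x ≫ ev
      = 𝟙 _ ⊗≫ y ◁ (coev ▷ x) ⊗≫ (ev ▷ (y ⊗ x) ≫ 𝟙_ C ◁ ev) ⊗≫ 𝟙 _ := by monoidal
    _ = 𝟙 _ ⊗≫ y ◁ (coev ▷ x) ⊗≫ ((y ⊗ x) ◁ ev ≫ ev ▷ 𝟙_ C) ⊗≫ 𝟙 _ := by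
        rw [whisker_exchange]
    _ = 𝟙 _ ⊗≫ y ◁ (coev ▷ x ≫ (α_ x y x).hom ≫ x ◁ ev) ⊗≫ ev ▷ 𝟙_ C ⊗≫ 𝟙 _ := by monoidal
    _ = 𝟙 _ ⊗≫ ev ⊗≫ 𝟙 _ := by rw [h₁]; monoidal
    _ = (((ρ_ y).hom ≫ (λ_ y).inv) ≫ (λ_ y).hom) ▷ x ≫ ev := by
        simp [monoidalComp]

end InternalHom

theorem isLeftRigid_of_isLeftClosed (hC : IsLeftClosed C)
    (h : ∀ (F : C ⥤ C) [F.LaxLeftLinear C], IsStrong F) : IsLeftRigid C := by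
  intro x
  obtain ⟨G, ⟨adj⟩⟩ := hC x
  let _ := internalHomLaxLeftLinear adj
  exact ⟨_, nonempty_exactPairing_of_isIso adj (h G x (𝟙_ C))⟩

/-- The structure morphism `x ⊗ F m ⟶ F (x ⊗ m)` of a lax module functor is invertible if `x` has a
left dual. -/
theorem isIso_of_exactPairing (F : C ⥤ C) [F.LaxLeftLinear C] (x y m : C) [ExactPairing x y] :
    IsIso (Functor.LaxLeftLinear.μₗ F x m) := by
  let μ (c d : C) : c ⊗ F.obj d ⟶ F.obj (c ⊗ d) := Functor.LaxLeftLinear.μₗ F c d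
  have nl {c c' : C} (f : c ⟶ c') (d : C) : f ▷ F.obj d ≫ μ c' d = μ c d ≫ F.map (f ▷ d) :=
    Functor.LaxLeftLinear.μₗ_naturality_left F f d
  have nr (c : C) {d d' : C} (f : d ⟶ d') : c ◁ F.map f ≫ μ c d' = μ c d ≫ F.map (c ◁ f) :=
    Functor.LaxLeftLinear.μₗ_naturality_right F c f
  have as (c c' d : C) : c ◁ μ c' d ≫ μ c (c' ⊗ d) =
      (α_ c c' (F.obj d)).inv ≫ μ (c ⊗ c') d ≫ F.map (α_ c c' d).hom := by
    rw [Iso.eq_inv_comp]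
    exact (Functor.LaxLeftLinear.μₗ_associativity F c c' d).symm
  have un (d : C) : μ (𝟙_ C) d ≫ F.map (λ_ d).hom = (λ_ (F.obj d)).hom :=
    (Functor.LaxLeftLinear.μₗ_unitality F d).symm
  let e : y ⊗ x ⊗ m ⟶ m := (α_ y x m).inv ≫ ε_ x y ▷ m ≫ (λ_ m).hom
  -- The candidate inverse: create `x ⊗ y`, absorb `y` into `F` by the lax structure, and evaluate
  -- `y ⊗ x` inside `F`.
  let ν : F.obj (x ⊗ m) ⟶ x ⊗ F.obj m :=
    (λ_ _).inv ≫ η_ x y ▷ F.obj (x ⊗ m) ≫ (α_ _ _ _).hom ≫ x ◁ (μ y (x ⊗ m) ≫ F.map e)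
  refine ⟨ν, ?_, ?_⟩
  · change μ x m ≫ ν = 𝟙 (x ⊗ F.obj m)
    -- Associativity, naturality and unitality of the lax structure let the evaluation be performed
    -- outside `F`; one composite is then a snake tensored with `F m`.
    have h : y ◁ μ x m ≫ μ y (x ⊗ m) ≫ F.map e =
        (α_ y x (F.obj m)).inv ≫ ε_ x y ▷ F.obj m ≫ (λ_ (F.obj m)).hom := by
      rw [← Category.assoc, as, Category.assoc, Category.assoc, ← F.map_comp]
      simp only [e, Iso.hom_inv_id_assoc]
      rw [F.map_comp, ← reassoc_of% nl, un]
    calc μ x m ≫ ν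
        = (λ_ _).inv ≫ (𝟙_ C ◁ μ x m ≫ η_ x y ▷ F.obj (x ⊗ m)) ≫ (α_ _ _ _).hom ≫
            x ◁ (μ y (x ⊗ m) ≫ F.map e) := by simp [ν]
      _ = (λ_ _).inv ≫ η_ x y ▷ (x ⊗ F.obj m) ≫ (α_ _ _ _).hom ≫
            x ◁ (y ◁ μ x m ≫ μ y (x ⊗ m) ≫ F.map e) := by
          rw [whisker_exchange]; simp
      _ = 𝟙 _ ⊗≫ (η_ x y ▷ x ≫ (α_ x y x).hom ≫ x ◁ ε_ x y) ▷ F.obj m ⊗≫ 𝟙 _ := by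
          rw [h]; monoidal
      _ = 𝟙 _ := by rw [ExactPairing.evaluation_coevaluation]; monoidal
  · change ν ≫ μ x m = 𝟙 (F.obj (x ⊗ m))
    -- Here everything is moved inside `F` instead, and the composite is `F` of a snake.
    calc ν ≫ μ x m
        = (λ_ _).inv ≫ η_ x y ▷ F.obj (x ⊗ m) ≫ (α_ _ _ _).hom ≫
            x ◁ μ y (x ⊗ m) ≫ x ◁ F.map e ≫ μ x m := by simp [ν]
      _ = (λ_ _).inv ≫ η_ x y ▷ F.obj (x ⊗ m) ≫ μ (x ⊗ y) (x ⊗ m) ≫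
            F.map ((α_ x y (x ⊗ m)).hom ≫ x ◁ e) := by
          rw [nr, reassoc_of% (as x y (x ⊗ m)), F.map_comp]; simp
      _ = F.map ((λ_ _).inv ≫ η_ x y ▷ (x ⊗ m) ≫ (α_ x y (x ⊗ m)).hom ≫ x ◁ e) := by
          rw [reassoc_of% nl, ← F.map_comp, ← cancel_epi (λ_ (F.obj (x ⊗ m))).hom]
          simp only [Iso.hom_inv_id_assoc]
          rw [← un, Category.assoc, ← F.map_comp]; simp
      _ = F.map (𝟙 _ ⊗≫ (η_ x y ▷ x ≫ (α_ x y x).hom ≫ x ◁ ε_ x y) ▷ m ⊗≫ 𝟙 _) := by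
          congr 1; simp only [e]; monoidal
      _ = F.map (𝟙 _) := by
          congr 1; rw [ExactPairing.evaluation_coevaluation]; monoidal
      _ = _ := F.map_id _

end Monoidal

/-! ### Finite-dimensional subcomodules -/

section Subcomodules

variable {k : Type u} [Field k] {B : Type u} [Ring B] [Bialgebra k B]
variable {M W : Type u} [AddCommGroup M] [Module k M] [AddCommGroup W] [Module k W]

/-- Contraction of the left leg of a tensor with a linear form. -/
def contractLeft (M : Type u) [AddCommGroup M] [Module k M] (φ : B →ₗ[k] k) :
    B ⊗[k] M →ₗ[k] M :=
  (TensorProduct.lid k M).toLinearMap ∘ₗ φ.rTensor M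

@[simp]
theorem contractLeft_tmul (φ : B →ₗ[k] k) (b : B) (m : M) :
    contractLeft M φ (b ⊗ₜ m) = φ b • m := by
  simp [contractLeft]

theorem contractLeft_lTensor (φ : B →ₗ[k] k) (i : W →ₗ[k] M) (t : B ⊗[k] W) :
    contractLeft M φ (i.lTensor B t) = i (contractLeft W φ t) := by
  induction t with
  | zero => simp
  | add x y hx hy => simp only [map_add, hx, hy]
  | tmul b w => simp

/-- Expand the left leg in a basis of `B`: the right-hand coefficients are contractions by
coordinate forms, and only finitely many are nonzero. -/
theorem exists_contractLeft_eq_sum (t : B ⊗[k] M) :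
    ∃ (s : Finset (Module.Basis.ofVectorSpaceIndex k B)),
      t = ∑ i ∈ s, Module.Basis.ofVectorSpace k B i ⊗ₜ[k]
        contractLeft M ((Module.Basis.ofVectorSpace k B).coord i) t := by
  classical
  let b := Module.Basis.ofVectorSpace k B
  have h := (TensorProduct.equivFinsuppOfBasisLeft (N := M) b).symm_apply_apply t
  rw [TensorProduct.equivFinsuppOfBasisLeft_symm_apply, Finsupp.sum] at h
  refine ⟨_, h.symm.trans (Finset.sum_congr rfl fun i _ => ?_)⟩
  rw [TensorProduct.equivFinsuppOfBasisLeft_apply]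
  rfl

/-- The span of all contractions of a tensor. -/
def contractions (t : B ⊗[k] M) : Submodule k M :=
  Submodule.span k (Set.range fun φ : B →ₗ[k] k => contractLeft M φ t)

theorem contractLeft_mem_contractions (φ : B →ₗ[k] k) (t : B ⊗[k] M) :
    contractLeft M φ t ∈ contractions t :=
  Submodule.subset_span ⟨φ, rfl⟩

/-- The finitely many coordinate contractions in the basis expansion span all the others. -/
theorem finite_contractions (t : B ⊗[k] M) : Module.Finite k (contractions t) := by
  classical
  obtain ⟨s, hs⟩ := exists_contractLeft_eq_sum t
  let N := Submodule.span k ((fun i => contractLeft M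
    ((Module.Basis.ofVectorSpace k B).coord i) t) '' (s : Set _))
  have : Module.Finite k N := Module.Finite.span_of_finite k (s.finite_toSet.image _)
  refine Submodule.finiteDimensional_of_le (S₂ := N) (Submodule.span_le.2 ?_)
  rintro _ ⟨φ, rfl⟩
  change contractLeft M φ t ∈ N
  rw [hs, map_sum]
  refine Submodule.sum_mem _ fun i hi => ?_
  rw [contractLeft_tmul]
  exact N.smul_mem _ (Submodule.subset_span ⟨i, hi, rfl⟩)

theorem mem_range_contractions (t : B ⊗[k] M) :
    t ∈ LinearMap.range ((contractions t).subtype.lTensor B) := by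
  obtain ⟨s, hs⟩ := exists_contractLeft_eq_sum t
  refine ⟨∑ i ∈ s, Module.Basis.ofVectorSpace k B i ⊗ₜ[k]
    ⟨_, contractLeft_mem_contractions ((Module.Basis.ofVectorSpace k B).coord i) t⟩, ?_⟩
  rw [map_sum]
  exact hs.symm

/-- Contracting the coaction with the counit returns `x`. -/
theorem mem_contractions_coact {f : M →ₗ[k] B ⊗[k] M} (hf : IsLeftCoaction f) (x : M) :
    x ∈ contractions (f x) := by
  have h := LinearMap.congr_fun hf.counit x
  have h' := contractLeft_mem_contractions (Coalgebra.counit (R := k) (A := B)) (f x)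
  simp only [LinearMap.comp_apply] at h
  simp only [contractLeft, LinearMap.comp_apply, h] at h'
  simpa using h'

theorem coact_contractLeft {f : M →ₗ[k] B ⊗[k] M} (φ : B →ₗ[k] k) (t : B ⊗[k] M) :
    f (contractLeft M φ t) = contractLeft (B ⊗[k] M) φ (f.lTensor B t) :=
  (contractLeft_lTensor φ f t).symm

theorem comul_natural (i : W →ₗ[k] M) (t : B ⊗[k] W) :
    TensorProduct.assoc k B B M ((Coalgebra.comul (R := k) (A := B)).rTensor M (i.lTensor B t)) =
      (i.lTensor B).lTensor B (TensorProduct.assoc k B B W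
        ((Coalgebra.comul (R := k) (A := B)).rTensor W t)) := by
  induction t with
  | zero => simp
  | add x y hx hy => simp only [map_add, hx, hy]
  | tmul b w =>
    simp only [LinearMap.lTensor_tmul, LinearMap.rTensor_tmul]
    generalize Coalgebra.comul (R := k) b = s
    induction s with
    | zero => simp
    | add x y hx hy => simp only [TensorProduct.add_tmul, map_add, hx, hy]
    | tmul a c => simp

/-- The local finiteness of comodules. By coassociativity, the coaction of a contraction of `f x` is
a contraction of `(Δ ⊗ id)(f x)`, whose last leg stays in the span of the contractions because that
of `f x` does. -/
theorem coact_mem_range_contractions {f : M →ₗ[k] B ⊗[k] M} (hf : IsLeftCoaction f) (x w : M)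
    (hw : w ∈ contractions (f x)) :
    f w ∈ LinearMap.range ((contractions (f x)).subtype.lTensor B) := by
  let N := (LinearMap.range ((contractions (f x)).subtype.lTensor B)).comap f
  change w ∈ N
  suffices h : contractions (f x) ≤ N from h hw
  refine Submodule.span_le.2 ?_
  rintro _ ⟨φ, rfl⟩
  change f (contractLeft M φ (f x)) ∈ LinearMap.range ((contractions (f x)).subtype.lTensor B)
  have h := LinearMap.congr_fun hf.coassoc x
  simp only [LinearMap.comp_apply, LinearEquiv.coe_coe] at h
  obtain ⟨s, hs⟩ := mem_range_contractions (f x)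
  have h' := comul_natural (contractions (f x)).subtype s
  rw [hs, h] at h'
  rw [coact_contractLeft, h', contractLeft_lTensor]
  exact ⟨_, rfl⟩

/-- The restriction of a coaction to a subspace. -/
def restrictCoact (f : M →ₗ[k] B ⊗[k] M) (i : W →ₗ[k] M) (hi : Function.Injective i)
    (h : ∀ w, f (i w) ∈ LinearMap.range (i.lTensor B)) : W →ₗ[k] B ⊗[k] W :=
  (LinearEquiv.ofInjective (i.lTensor B)
    (Module.Flat.lTensor_preserves_injective_linearMap i hi)).symm.toLinearMap ∘ₗ
      LinearMap.codRestrict _ (f ∘ₗ i) h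

theorem lTensor_restrictCoact (f : M →ₗ[k] B ⊗[k] M) (i : W →ₗ[k] M) (hi : Function.Injective i)
    (h : ∀ w, f (i w) ∈ LinearMap.range (i.lTensor B)) (w : W) :
    i.lTensor B (restrictCoact f i hi h w) = f (i w) := by
  have e := (LinearEquiv.ofInjective (i.lTensor B)
    (Module.Flat.lTensor_preserves_injective_linearMap i hi)).apply_symm_apply
      (LinearMap.codRestrict _ (f ∘ₗ i) h w)
  exact congrArg Subtype.val e

/-- A coaction which is the restriction of a (coassociative and counital) coaction along an
injective map is coassociative and counital. -/
theorem IsLeftCoaction.of_injective {f : M →ₗ[k] B ⊗[k] M} (hf : IsLeftCoaction f)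
    {g : W →ₗ[k] B ⊗[k] W} (i : W →ₗ[k] M) (hi : Function.Injective i)
    (h : ∀ w, i.lTensor B (g w) = f (i w)) : IsLeftCoaction g where
  coassoc := by
    ext w
    have h₁ := LinearMap.congr_fun hf.coassoc (i w)
    simp only [LinearMap.comp_apply, LinearEquiv.coe_coe] at h₁ ⊢
    apply Module.Flat.lTensor_preserves_injective_linearMap (M := B) (i.lTensor B)
      (Module.Flat.lTensor_preserves_injective_linearMap i hi)
    rw [← comul_natural, h, h₁, ← h, ← LinearMap.lTensor_comp_apply,
      ← LinearMap.lTensor_comp_apply]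
    congr 2
    ext w
    exact (h w).symm
  counit := by
    ext w
    have h₁ := LinearMap.congr_fun hf.counit (i w)
    simp only [LinearMap.comp_apply] at h₁ ⊢
    apply (TensorProduct.lid k W).injective
    apply hi
    rw [← h] at h₁
    have h₂ := contractLeft_lTensor (Coalgebra.counit (R := k) (A := B)) i (g w)
    simp only [contractLeft, LinearMap.comp_apply, LinearEquiv.coe_coe, h₁] at h₂
    rw [← h₂]
    simp

namespace LeftComod

/-- A subspace `i : W → M` of a comodule `M` which is stable under the coaction. -/
def restrict (M : LeftComod k B) (i : W →ₗ[k] M.V) (hi : Function.Injective i)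
    (h : ∀ w, M.coact (i w) ∈ LinearMap.range (i.lTensor B)) : LeftComod k B where
  V := ModuleCat.of k W
  coact := restrictCoact M.coact i hi h
  isLeftCoaction := M.isLeftCoaction.of_injective i hi
    (lTensor_restrictCoact M.coact i hi h)

/-- The inclusion of a subcomodule. -/
def restrictHom (M : LeftComod k B) (i : W →ₗ[k] M.V) (hi : Function.Injective i)
    (h : ∀ w, M.coact (i w) ∈ LinearMap.range (i.lTensor B)) : M.restrict i hi h ⟶ M where
  toLin := i
  comm := LinearMap.ext fun w => (lTensor_restrictCoact M.coact i hi h w).symm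

end LeftComod

/-! ### Coefficient matrices -/

variable {n : Type} [Fintype n]

/-- `c` is a comatrix: `Δ(c i j) = ∑ l, c i l ⊗ c l j` and `ε(c i j) = δ i j`. -/
structure IsComatrix [DecidableEq n] (k : Type u) [Field k] {B : Type u} [Ring B] [Bialgebra k B]
    (c : Matrix n n B) : Prop where
  comul : ∀ i j, Coalgebra.comul (R := k) (c i j) = ∑ l, c i l ⊗ₜ[k] c l j
  counit : ∀ i j, Coalgebra.counit (R := k) (c i j) = (1 : Matrix n n k) i j

/-- The matrix `c` of a coaction `f` in a basis `e`: `f (e i) = ∑ j, c i j ⊗ e j`. -/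
def coeffMatrix (e : Module.Basis n k M) (f : M →ₗ[k] B ⊗[k] M) : Matrix n n B := fun i j =>
  TensorProduct.rid k B ((e.coord j).lTensor B (f (e i)))

theorem eq_sum_tmul_basis (e : Module.Basis n k M) (t : B ⊗[k] M) :
    t = ∑ j, TensorProduct.rid k B ((e.coord j).lTensor B t) ⊗ₜ[k] e j := by
  induction t with
  | zero => simp
  | add x y hx hy =>
    simp only [map_add, TensorProduct.add_tmul, Finset.sum_add_distrib]
    rw [← hx, ← hy]
  | tmul b m =>
    simp only [LinearMap.lTensor_tmul, TensorProduct.rid_tmul, TensorProduct.smul_tmul,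
      ← TensorProduct.tmul_sum]
    congr 1
    exact (e.sum_repr m).symm

theorem sum_tmul_basis_injective [DecidableEq n] {A : Type u} [AddCommGroup A] [Module k A]
    (e : Module.Basis n k M) {a a' : n → A}
    (h : ∑ j, a j ⊗ₜ[k] e j = ∑ j, a' j ⊗ₜ[k] e j) : a = a' := by
  funext j
  have h' := congrArg (fun t => TensorProduct.rid k A ((e.coord j).lTensor A t)) h
  simpa [Finsupp.single_apply] using h'

theorem coact_basis (e : Module.Basis n k M) (f : M →ₗ[k] B ⊗[k] M) (i : n) :
    f (e i) = ∑ j, coeffMatrix e f i j ⊗ₜ[k] e j :=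
  eq_sum_tmul_basis e _

/-- Compare the coefficients of each basis vector in the coassociativity and counit laws. -/
theorem isComatrix_coeffMatrix [DecidableEq n] (e : Module.Basis n k M) {f : M →ₗ[k] B ⊗[k] M}
    (hf : IsLeftCoaction f) : IsComatrix k (coeffMatrix e f) where
  comul i j := by
    have h := LinearMap.congr_fun hf.coassoc (e i)
    simp only [LinearMap.comp_apply, LinearEquiv.coe_coe, coact_basis e f i, map_sum,
      LinearMap.rTensor_tmul, LinearMap.lTensor_tmul] at h
    rw [← map_sum, ← LinearEquiv.eq_symm_apply, map_sum] at h
    simp only [coact_basis e f, TensorProduct.tmul_sum, map_sum, TensorProduct.assoc_symm_tmul] at h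
    rw [Finset.sum_comm] at h
    simp only [← TensorProduct.sum_tmul] at h
    exact congrFun (sum_tmul_basis_injective e h) j
  counit i j := by
    have h := LinearMap.congr_fun hf.counit (e i)
    simp only [LinearMap.comp_apply, coact_basis e f i, map_sum, LinearMap.rTensor_tmul,
      TensorProduct.mk_apply] at h
    have h' : (1 : k) ⊗ₜ[k] e i = ∑ j, (1 : Matrix n n k) i j ⊗ₜ[k] e j := by
      rw [Finset.sum_eq_single i]
      · simp
      · intro j _ hj
        simp [Matrix.one_apply_ne hj.symm]
      · simp
    exact congrFun (sum_tmul_basis_injective e (h.trans h')) j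

/-- Every element of `B` is a linear combination of the coefficients of a comatrix. -/
theorem exists_comatrix (b : B) :
    ∃ (d : ℕ) (c : Matrix (Fin d) (Fin d) B) (a : Fin d → Fin d → k), IsComatrix k c ∧
      b = ∑ i, ∑ j, a i j • c i j := by
  -- Work in the finite-dimensional subcomodule of the regular comodule generated by `b`.
  let Δ := Coalgebra.comul (R := k) (A := B)
  let W := contractions (Δ b)
  have hW : ∀ w : W, Δ (W.subtype w) ∈ LinearMap.range (W.subtype.lTensor B) := fun w =>
    coact_mem_range_contractions isLeftCoaction_comul b w w.2
  let g := restrictCoact Δ W.subtype W.subtype_injective hW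
  have hg := lTensor_restrictCoact Δ W.subtype W.subtype_injective hW
  have hg' : IsLeftCoaction g :=
    isLeftCoaction_comul.of_injective W.subtype W.subtype_injective hg
  have : Module.Finite k W := finite_contractions _
  let e := Module.finBasis k W
  let x : W := ⟨b, mem_contractions_coact isLeftCoaction_comul b⟩
  -- Applying `id ⊗ ε` to `Δ(e i) = ∑ c i j ⊗ e j` gives `e i = ∑ ε(e j) c i j`; this is combined
  -- with the expansion of `b` in the basis `e`.
  refine ⟨_, coeffMatrix e g, fun i j => e.repr x i * Coalgebra.counit (e j : B),
    isComatrix_coeffMatrix e hg', ?_⟩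
  have h (i) : (e i : B) = ∑ j, Coalgebra.counit (R := k) (e j : B) • coeffMatrix e g i j := by
    have h₁ := hg (e i)
    change W.subtype.lTensor B (g (e i)) = Δ (e i : B) at h₁
    have h₂ := Coalgebra.lTensor_counit_comul (R := k) (e i : B)
    rw [← h₁, coact_basis e g i] at h₂
    simpa [TensorProduct.smul_tmul'] using (congrArg (TensorProduct.rid k B) h₂).symm
  have h₁ : b = ∑ i, e.repr x i • (e i : B) := by
    have h₂ := congrArg W.subtype (e.sum_repr x)
    rw [map_sum] at h₂
    exact h₂.symm
  rw [h₁]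
  refine Finset.sum_congr rfl fun i _ => ?_
  rw [h i, Finset.smul_sum]
  simp only [mul_smul]

end Subcomodules

/-! ### The Galois map and twisted antipodes -/

section Galois

variable {k : Type u} [Field k] {B : Type u} [Ring B] [Bialgebra k B]

variable (k B) in
/-- The Galois map `a ⊗ b ↦ a₍₁₎ b ⊗ a₍₂₎`. -/
def galois : B ⊗[k] B →ₗ[k] B ⊗[k] B :=
  LinearMap.mul' k (B ⊗[k] B) ∘ₗ
    TensorProduct.map Coalgebra.comul ((TensorProduct.mk k B B).flip 1)

@[simp]
theorem galois_tmul (a b : B) :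
    galois k B (a ⊗ₜ b) = Coalgebra.comul (R := k) a * (b ⊗ₜ[k] 1) := rfl

/-- Right `B`-linearity: an inverse of the Galois map is determined by its values on `1 ⊗ B`. -/
theorem galois_lTensor_mulRight (b : B) (t : B ⊗[k] B) :
    galois k B ((LinearMap.mulRight k b).lTensor B t) = galois k B t * (b ⊗ₜ[k] 1) := by
  induction t with
  | zero => simp
  | add x y hx hy => simp only [map_add, hx, hy, add_mul]
  | tmul a c => simp [mul_assoc]

theorem lTensor_counit_galois (t : B ⊗[k] B) :
    TensorProduct.rid k B ((Coalgebra.counit (R := k) (A := B)).lTensor B (galois k B t)) =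
      LinearMap.mul' k B t := by
  induction t with
  | zero => simp
  | add x y hx hy => simp only [map_add, hx, hy]
  | tmul a b =>
    have h (s : B ⊗[k] B) : TensorProduct.rid k B ((Coalgebra.counit (R := k) (A := B)).lTensor B
        (s * (b ⊗ₜ[k] 1))) =
        TensorProduct.rid k B ((Coalgebra.counit (R := k) (A := B)).lTensor B s) * b := by
      induction s with
      | zero => simp
      | add x y hx hy => simp only [add_mul, map_add, hx, hy]
      | tmul c d => simp
    rw [galois_tmul, h, Coalgebra.lTensor_counit_comul]
    simp

/-- Right colinearity, a form of coassociativity. It forces the shape `b₍₂₎ ⊗ T(b₍₁₎)` of the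
inverse at `1 ⊗ b`. -/
theorem rTensor_galois_freeRcoact (t : B ⊗[k] B) :
    (galois k B).rTensor B (Trimod.freeRcoact B B t) = (TensorProduct.assoc k B B B).symm
      ((Coalgebra.comul (R := k) (A := B)).lTensor B (galois k B t)) := by
  induction t with
  | zero => simp
  | add x y hx hy => simp only [map_add, hx, hy]
  | tmul a b =>
    have h₁ (s : B ⊗[k] B) : TensorProduct.assoc k B B B ((galois k B).rTensor B
        (TensorProduct.rightComm k B B B (s ⊗ₜ b))) =
        TensorProduct.assoc k B B B ((Coalgebra.comul (R := k) (A := B)).rTensor B s) *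
          (b ⊗ₜ[k] 1) := by
      induction s with
      | zero => simp
      | add x y hx hy => simp only [TensorProduct.add_tmul, map_add, hx, hy, add_mul]
      | tmul c d =>
        simp only [TensorProduct.rightComm_tmul, LinearMap.rTensor_tmul, galois_tmul]
        generalize Coalgebra.comul (R := k) c = r
        induction r with
        | zero => simp
        | add x y hx hy => simp only [TensorProduct.add_tmul, map_add, hx, hy, add_mul]
        | tmul p q => simp [Algebra.TensorProduct.one_def]
    have h₂ (s : B ⊗[k] B) : (Coalgebra.comul (R := k) (A := B)).lTensor B (s * (b ⊗ₜ[k] 1)) =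
        (Coalgebra.comul (R := k) (A := B)).lTensor B s * (b ⊗ₜ[k] 1) := by
      induction s with
      | zero => simp
      | add x y hx hy => simp only [add_mul, map_add, hx, hy]
      | tmul c d => simp
    rw [LinearEquiv.eq_symm_apply, galois_tmul, Trimod.freeRcoact_tmul, h₁, h₂,
      Coalgebra.coassoc_apply]

theorem contractLeft_counit_freeRcoact {M : Type u} [AddCommGroup M] [Module k M]
    (t : B ⊗[k] M) :
    (contractLeft M (Coalgebra.counit (R := k) (A := B))).rTensor B (Trimod.freeRcoact B M t) =
      TensorProduct.comm k B M t := by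
  induction t with
  | zero => simp
  | add x y hx hy => simp only [map_add, hx, hy]
  | tmul b m =>
    have h (s : B ⊗[k] B) : (contractLeft M (Coalgebra.counit (R := k) (A := B))).rTensor B
        (TensorProduct.rightComm k B B M (s ⊗ₜ m)) =
        m ⊗ₜ TensorProduct.lid k B ((Coalgebra.counit (R := k) (A := B)).rTensor B s) := by
      induction s with
      | zero => simp
      | add x y hx hy =>
        simp only [TensorProduct.add_tmul, TensorProduct.tmul_add, map_add, hx, hy]
      | tmul c d => simp [TensorProduct.smul_tmul]
    rw [Trimod.freeRcoact_tmul, h, Coalgebra.rTensor_counit_comul]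
    simp

/-- The coinvariants of `B ⊗ M` are `1 ⊗ M`. -/
theorem eq_one_tmul_of_freeRcoact {M : Type u} [AddCommGroup M] [Module k M] {t : B ⊗[k] M}
    (h : Trimod.freeRcoact B M t = t ⊗ₜ[k] 1) :
    t = 1 ⊗ₜ[k] contractLeft M (Coalgebra.counit (R := k) (A := B)) t := by
  have h' := contractLeft_counit_freeRcoact t
  rw [h] at h'
  apply (TensorProduct.comm k B M).injective
  rw [← h']
  simp

/-- `T(b)` is read off the inverse at `1 ⊗ b` by applying the counit to the first leg. -/
theorem hasTwistedAntipode_of_bijective (h : Function.Bijective (galois k B)) :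
    HasTwistedAntipode k B := by
  let g := LinearEquiv.ofBijective (galois k B) h
  have hg (t : B ⊗[k] B) : galois k B (g.symm t) = t := g.apply_symm_apply t
  have gh (t : B ⊗[k] B) : g.symm (galois k B t) = t := g.symm_apply_apply t
  let c := contractLeft B (Coalgebra.counit (R := k) (A := B))
  let T : B →ₗ[k] B := c ∘ₗ g.symm.toLinearMap ∘ₗ TensorProduct.mk k B B 1
  have hT (b : B) : T b = c (g.symm (1 ⊗ₜ b)) := rfl
  -- The inverse is right colinear too, and an element of `B ⊗ B` is recovered from its right
  -- coaction by the counit.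
  have hs (b : B) : TensorProduct.comm k B B (g.symm (1 ⊗ₜ b)) =
      T.rTensor B (Coalgebra.comul b) := by
    have h₁ := rTensor_galois_freeRcoact (g.symm (1 ⊗ₜ[k] b))
    rw [hg, LinearMap.lTensor_tmul] at h₁
    have h₂ : Trimod.freeRcoact B B (g.symm (1 ⊗ₜ[k] b)) =
        (g.symm.toLinearMap ∘ₗ TensorProduct.mk k B B 1).rTensor B (Coalgebra.comul b) := by
      have e : g.symm.toLinearMap.rTensor B ((galois k B).rTensor B
          (Trimod.freeRcoact B B (g.symm (1 ⊗ₜ[k] b)))) =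
          Trimod.freeRcoact B B (g.symm (1 ⊗ₜ[k] b)) := by
        rw [← LinearMap.rTensor_comp_apply]
        have : g.symm.toLinearMap ∘ₗ galois k B = LinearMap.id := LinearMap.ext gh
        rw [this, LinearMap.rTensor_id, LinearMap.id_apply]
      rw [← e, h₁, LinearMap.rTensor_comp_apply]
      congr 1
    rw [← contractLeft_counit_freeRcoact, h₂, ← LinearMap.rTensor_comp_apply]
  have hT' (a b : B) : c (g.symm (a ⊗ₜ b)) = T b * a := by
    have e : g.symm (a ⊗ₜ b) = (LinearMap.mulRight k a).lTensor B (g.symm (1 ⊗ₜ b)) := by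
      apply g.injective
      change galois k B _ = galois k B _
      rw [galois_lTensor_mulRight, hg, hg]
      simp
    rw [e]
    change contractLeft B _ _ = _
    rw [contractLeft_lTensor]
    rfl
  refine ⟨T, fun b => ?_, fun b => ?_⟩
  -- The Galois map sends `b ⊗ 1` to `Δ(b)`; hence `T(b₍₂₎) b₍₁₎` is the counit contraction of `b ⊗
  -- 1`.
  · have e (s : B ⊗[k] B) : c (g.symm s) =
        LinearMap.mul' k B (T.rTensor B (TensorProduct.comm k B B s)) := by
      induction s with
      | zero => simp
      | add x y hx hy => simp only [map_add, hx, hy]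
      | tmul p q => simp [hT']
    rw [← e]
    have h₁ := gh (b ⊗ₜ 1)
    rw [galois_tmul, ← Algebra.TensorProduct.one_def, mul_one] at h₁
    rw [h₁]
    simp [c, Algebra.algebraMap_eq_smul_one]
  -- Multiplication equals `id ⊗ ε` after the Galois map, so `b₍₂₎ T(b₍₁₎)` is `id ⊗ ε` of `1 ⊗ b`.
  · have e : T.lTensor B (TensorProduct.comm k B B (Coalgebra.comul b)) = g.symm (1 ⊗ₜ b) := by
      apply (TensorProduct.comm k B B).injective
      rw [hs]
      generalize Coalgebra.comul (R := k) b = s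
      induction s with
      | zero => simp
      | add x y hx hy => simp only [map_add, hx, hy]
      | tmul p q => simp
    rw [e, ← lTensor_counit_galois, hg]
    simp [Algebra.algebraMap_eq_smul_one]

end Galois

/-! ### Cofree comodules -/

section Cofree

variable {k : Type u} [Field k] {B : Type u} [Ring B] [Bialgebra k B]

variable (B) in
/-- The coaction of the cofree comodule `B ⊗ V`. -/
def cofreeCoact (V : Type u) [AddCommGroup V] [Module k V] :
    B ⊗[k] V →ₗ[k] B ⊗[k] (B ⊗[k] V) :=
  (TensorProduct.assoc k B B V).toLinearMap ∘ₗ (Coalgebra.comul (R := k) (A := B)).rTensor V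

theorem cofreeCoact_tmul {V : Type u} [AddCommGroup V] [Module k V] (b : B) (v : V) :
    cofreeCoact B V (b ⊗ₜ[k] v) =
      ((TensorProduct.mk k B V).flip v).lTensor B (Coalgebra.comul (R := k) b) := by
  simp only [cofreeCoact, LinearMap.comp_apply, LinearMap.rTensor_tmul, LinearEquiv.coe_coe]
  generalize Coalgebra.comul (R := k) b = s
  induction s with
  | zero => simp
  | add x y hx hy => simp only [TensorProduct.add_tmul, map_add, hx, hy]
  | tmul p q => simp

theorem cofreeCoact_lTensor {V W : Type u} [AddCommGroup V] [Module k V] [AddCommGroup W]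
    [Module k W] (f : V →ₗ[k] W) (t : B ⊗[k] V) :
    cofreeCoact B W (f.lTensor B t) = (f.lTensor B).lTensor B (cofreeCoact B V t) :=
  comul_natural f t

theorem isLeftCoaction_cofreeCoact (V : Type u) [AddCommGroup V] [Module k V] :
    IsLeftCoaction (cofreeCoact (k := k) B V) where
  coassoc := by
    refine TensorProduct.ext' fun b v => ?_
    simp only [LinearMap.comp_apply, LinearEquiv.coe_coe]
    rw [cofreeCoact_tmul, comul_natural, Coalgebra.coassoc_apply, ← LinearMap.lTensor_comp_apply,
      ← LinearMap.lTensor_comp_apply]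
    congr 2
    ext c
    exact (cofreeCoact_tmul c v).symm
  counit := by
    refine TensorProduct.ext' fun b v => ?_
    have h := contractLeft_lTensor (Coalgebra.counit (R := k) (A := B))
      ((TensorProduct.mk k B V).flip v) (Coalgebra.comul (R := k) b)
    apply (TensorProduct.lid k _).injective
    simp only [LinearMap.comp_apply]
    rw [cofreeCoact_tmul]
    refine h.trans ?_
    simp only [contractLeft, LinearMap.comp_apply, LinearEquiv.coe_coe,
      Coalgebra.rTensor_counit_comul]
    simp

theorem contractLeft_counit_coact {M : Type u} [AddCommGroup M] [Module k M]
    {f : M →ₗ[k] B ⊗[k] M} (hf : IsLeftCoaction f) (m : M) :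
    contractLeft M (Coalgebra.counit (R := k) (A := B)) (f m) = m := by
  have h := LinearMap.congr_fun hf.counit m
  simp only [LinearMap.comp_apply] at h
  simp [contractLeft, h]

namespace LeftComod

variable (k B) in
/-- The functor which sends a vector space `V` to the cofree comodule `B ⊗ V`. -/
def cofree : ModuleCat.{u} k ⥤ LeftComod k B where
  obj V :=
    { V := ModuleCat.of k (B ⊗[k] V)
      coact := cofreeCoact B V
      isLeftCoaction := isLeftCoaction_cofreeCoact V }
  map f := ⟨f.hom.lTensor B, LinearMap.ext fun t => cofreeCoact_lTensor f.hom t⟩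
  map_id V := hom_ext (LinearMap.lTensor_id B V)
  map_comp f g := hom_ext (LinearMap.lTensor_comp B g.hom f.hom)

variable (k B) in
/-- Cofree comodules are right adjoint to the forgetful functor. -/
def forgetAdj : forget k B ⊣ cofree k B :=
  Adjunction.mkOfUnitCounit
    { unit :=
        { app := fun M => ⟨M.coact, M.isLeftCoaction.coassoc⟩
          naturality := fun _ _ f => hom_ext f.comm }
      counit :=
        { app := fun V => ModuleCat.ofHom (contractLeft V (Coalgebra.counit (R := k) (A := B)))
          naturality := fun _ _ f =>
            ModuleCat.hom_ext (LinearMap.ext fun t => contractLeft_lTensor _ f.hom t) }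
      left_triangle := by
        ext M : 2
        refine ModuleCat.hom_ext (LinearMap.ext fun m => ?_)
        exact contractLeft_counit_coact M.isLeftCoaction m
      right_triangle := by
        ext V : 2
        refine hom_ext (TensorProduct.ext' fun b v => ?_)
        change (contractLeft V (Coalgebra.counit (R := k) (A := B))).lTensor B
          (cofreeCoact B V (b ⊗ₜ[k] v)) = b ⊗ₜ[k] v
        rw [cofreeCoact_tmul, ← LinearMap.lTensor_comp_apply]
        have h : contractLeft V (Coalgebra.counit (R := k) (A := B)) ∘ₗ
            (TensorProduct.mk k B V).flip v =
            (LinearMap.toSpanSingleton k V v) ∘ₗ Coalgebra.counit (R := k) (A := B) := by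
          ext c; simp
        rw [h, LinearMap.lTensor_comp_apply, Coalgebra.lTensor_counit_comul]
        simp }

/-- The comonad of the adjunction is `B ⊗ -`, and its coalgebras are the comodules. Comonadicity of
the forgetful functor then lets limits and colimits be computed on vector spaces. -/
instance : (Comonad.comparison (forgetAdj k B)).Full where
  map_surjective {M N} f := ⟨⟨f.f.hom, by
    have h := congrArg ModuleCat.Hom.hom f.h
    exact h.symm⟩, rfl⟩

instance : (Comonad.comparison (forgetAdj k B)).EssSurj where
  mem_essImage A := by
    let M : LeftComod k B :=
      { V := A.A
        coact := A.a.hom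
        isLeftCoaction :=
          { coassoc := congrArg ModuleCat.Hom.hom A.coassoc
            counit := by
              have h := congrArg ModuleCat.Hom.hom A.counit
              refine LinearMap.ext fun x => (TensorProduct.lid k _).injective ?_
              exact (LinearMap.congr_fun h x).trans (one_smul k x).symm } }
    refine ⟨M, ⟨Comonad.Coalgebra.isoMk (Iso.refl _) ?_⟩⟩
    refine ModuleCat.hom_ext (LinearMap.ext fun x => ?_)
    exact LinearMap.congr_fun (LinearMap.lTensor_id B A.A) _

instance : ComonadicLeftAdjoint (forget k B) where
  R := cofree k B
  adj := forgetAdj k B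
  eqv := { }

variable (k B) in
/-- The vector space underlying a cofree comodule is the tensor product with `B`. -/
def cofreeForget : tensorLeft (ModuleCat.of k B) ≅ cofree k B ⋙ forget k B :=
  NatIso.ofComponents (fun _ => Iso.refl _) fun _ => ModuleCat.MonoidalCategory.tensor_ext
    fun _ _ => rfl

/-- Over a field `B ⊗ -` is exact, and a comonadic functor creates the limits which its comonad
preserves. -/
instance : PreservesFiniteLimits (forget k B) where
  preservesFiniteLimits J _ _ := by
    have : PreservesLimitsOfShape J (cofree k B ⋙ forget k B) :=
      preservesLimitsOfShape_of_natIso (cofreeForget k B)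
    have : PreservesLimitsOfShape J (comonadicRightAdjoint (forget k B) ⋙ forget k B) := this
    refine ⟨fun {K} => ?_⟩
    let _ : CreatesLimit K (forget k B) := comonadicCreatesLimitOfPreservesLimit _ _
    infer_instance

/-- The forgetful functor reflects colimits, and after it the cofree functor becomes `B ⊗ -`. -/
instance : PreservesFilteredColimits (cofree k B) where
  preserves_filtered_colimits J _ _ := by
    have : PreservesColimitsOfShape J (cofree k B ⋙ forget k B) :=
      preservesColimitsOfShape_of_natIso (cofreeForget k B)
    let _ : CreatesColimitsOfSize.{u, u} (forget k B) := comonadicCreatesColimits _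
    exact preservesColimitsOfShape_of_reflects_of_preserves (cofree k B) (forget k B)

variable (k B) in
/-- The left exact finitary endofunctor `M ↦ B ⊗ M` of the category of comodules, where `B ⊗ M`
is the cofree comodule on the underlying vector space of `M`. -/
def cofreeEndo : LeftComod k B ⥤ LeftComod k B := forget k B ⋙ cofree k B

instance : PreservesFiniteLimits (cofreeEndo k B) := by
  have : PreservesLimitsOfSize.{0, 0} (cofree k B) := (forgetAdj k B).rightAdjoint_preservesLimits
  exact comp_preservesFiniteLimits _ _

instance : PreservesFilteredColimits (cofreeEndo k B) := by
  have : PreservesColimitsOfSize.{u, u} (forget k B) := (forgetAdj k B).leftAdjoint_preservesColimits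
  have : PreservesFilteredColimits (forget k B) := inferInstance
  exact comp_preservesFilteredColimits _ _

/-- The structure morphism `c ⊗ (b ⊗ m) ↦ c₍₋₁₎ b ⊗ (c₍₀₎ ⊗ m)` of the functor `cofreeEndo`. -/
def cofreeLax (M N : LeftComod k B) :
    M ⊗ (cofreeEndo k B).obj N ⟶ (cofreeEndo k B).obj (M ⊗ N) where
  toLin := mulLeft k B M.V N.V ∘ₗ M.coact.rTensor (B ⊗[k] N.V)
  comm := by
    refine TensorProduct.ext' fun m t => ?_
    have h := LinearMap.congr_fun M.isLeftCoaction.coassoc m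
    simp only [LinearMap.comp_apply, LinearEquiv.coe_coe] at h
    change cofreeCoact B (M.V ⊗[k] N.V) (mulLeft k B M.V N.V (M.coact m ⊗ₜ t)) =
      (mulLeft k B M.V N.V ∘ₗ M.coact.rTensor (B ⊗[k] N.V)).lTensor B
        (mulLeft k B M.V (B ⊗[k] N.V) (M.coact m ⊗ₜ cofreeCoact B N.V t))
    have h₁ := mulLeft_natural M.coact (LinearMap.id (R := k) (M := B ⊗[k] N.V)) (M.coact m)
      (cofreeCoact B N.V t)
    rw [LinearMap.lTensor_id, LinearMap.id_apply] at h₁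
    -- Colinearity rests on multiplicativity of `Δ` and then coassociativity of the coaction of `M`.
    refine (comul_mulLeft (M.coact m) t).trans ?_
    rw [h]
    refine (congrArg _ h₁).trans ?_
    rw [LinearMap.lTensor_comp_apply]
    rfl

/-- Naturality in the first variable is colinearity; the two coherence laws are associativity and
unitality of the product of `B`. -/
instance : (cofreeEndo k B).LaxLeftLinear (LeftComod k B) where
  μₗ M N := cofreeLax M N
  μₗ_naturality_left {M M'} f N := by
    refine hom_ext (TensorProduct.ext' fun m (t : B ⊗[k] N.V) => ?_)
    have h := LinearMap.congr_fun f.comm m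
    have h₁ := mulLeft_natural f.toLin (LinearMap.id (R := k) (M := N.V)) (M.coact m) t
    rw [LinearMap.lTensor_id, LinearMap.id_apply] at h₁
    exact (congrArg (fun z => mulLeft k B M'.V N.V (z ⊗ₜ[k] t)) h).trans h₁
  μₗ_naturality_right M {N N'} f := by
    refine hom_ext (TensorProduct.ext' fun m (t : B ⊗[k] N.V) => ?_)
    have h₁ := mulLeft_natural (LinearMap.id (R := k) (M := M.V)) f.toLin (M.coact m) t
    rw [LinearMap.lTensor_id, LinearMap.id_apply] at h₁
    exact h₁
  μₗ_associativity M M' N :=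
    hom_ext (TensorProduct.ext_threefold fun m m' t =>
      (assoc_mulLeft (M.coact m) (M'.coact m') t).symm)
  μₗ_unitality N := by
    refine hom_ext (TensorProduct.ext' fun c t => ?_)
    exact lid_mulLeft (k := k) c t

/-- The regular comodule. -/
def regular (k : Type u) [Field k] (B : Type u) [Ring B] [Bialgebra k B] : LeftComod k B where
  V := ModuleCat.of k B
  coact := Coalgebra.comul
  isLeftCoaction := isLeftCoaction_comul

theorem bijective_of_isIso {M N : LeftComod k B} (f : M ⟶ N) [IsIso f] :
    Function.Bijective f.toLin := by
  refine Function.bijective_iff_has_inverse.2 ⟨(inv f).toLin, fun x => ?_, fun x => ?_⟩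
  · exact LinearMap.congr_fun (congrArg Hom.toLin (IsIso.hom_inv_id f)) x
  · exact LinearMap.congr_fun (congrArg Hom.toLin (IsIso.inv_hom_id f)) x

/-- At the regular comodule and the unit, the structure morphism is `a ⊗ b ↦ a₍₁₎ b ⊗ a₍₂₎` once `B
⊗ k` is identified with `B` on both sides. -/
theorem bijective_galois_of_isStrong (h : IsStrong (cofreeEndo k B)) :
    Function.Bijective (galois k B) := by
  have h₁ : IsIso (cofreeLax (regular k B) (𝟙_ (LeftComod k B))) := h (regular k B) (𝟙_ _)
  have h₂ := bijective_of_isIso (cofreeLax (regular k B) (𝟙_ (LeftComod k B)))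
  let e : B ⊗[k] (B ⊗[k] k) ≃ₗ[k] B ⊗[k] B := LinearEquiv.lTensor B (TensorProduct.rid k B)
  have h₃ : galois k B ∘ e =
      e ∘ (cofreeLax (regular k B) (𝟙_ (LeftComod k B))).toLin := by
    suffices h : galois k B ∘ₗ e.toLinearMap = e.toLinearMap ∘ₗ
        (cofreeLax (regular k B) (𝟙_ (LeftComod k B))).toLin from
      congrArg (fun f : B ⊗[k] (B ⊗[k] k) →ₗ[k] B ⊗[k] B => ⇑f) h
    refine TensorProduct.ext_threefold' fun a b c => ?_
    change galois k B (a ⊗ₜ[k] TensorProduct.rid k B (b ⊗ₜ[k] c)) =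
      (TensorProduct.rid k B).toLinearMap.lTensor B
        (mulLeft k B B k (Coalgebra.comul (R := k) a ⊗ₜ (b ⊗ₜ c)))
    rw [galois_tmul]
    generalize Coalgebra.comul (R := k) a = s
    induction s with
    | zero => simp
    | add x y hx hy => simp only [TensorProduct.add_tmul, map_add, hx, hy, add_mul]
    | tmul p q => simp [TensorProduct.smul_tmul']
  have h₄ : Function.Bijective (galois k B ∘ e) := h₃ ▸ e.bijective.comp h₂
  exact (Function.Bijective.of_comp_iff _ e.bijective).1 h₄

end LeftComod

end Cofree

/-! ### The Hopf trimodule `B ⊗ B` with the diagonal action -/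

section Diagonal

variable {k : Type u} [Field k] {B : Type u} [Ring B] [Bialgebra k B]

variable (k B) in
/-- The diagonal action of `B` on `B ⊗ B`. -/
def diagAct : B ⊗[k] (B ⊗[k] B) →ₗ[k] B ⊗[k] B :=
  LinearMap.mul' k (B ⊗[k] B) ∘ₗ (Coalgebra.comul (R := k) (A := B)).rTensor (B ⊗[k] B)

@[simp]
theorem diagAct_tmul (a : B) (t : B ⊗[k] B) :
    diagAct k B (a ⊗ₜ t) = Coalgebra.comul (R := k) a * t := rfl

variable (k B) in
/-- The right coaction `b ⊗ c ↦ b ⊗ c₍₁₎ ⊗ c₍₂₎` of `B` on `B ⊗ B`. -/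
def comulRight : B ⊗[k] B →ₗ[k] (B ⊗[k] B) ⊗[k] B :=
  (TensorProduct.assoc k B B B).symm.toLinearMap ∘ₗ
    (Coalgebra.comul (R := k) (A := B)).lTensor B

theorem comulRight_tmul (b c : B) : comulRight k B (b ⊗ₜ c) =
    (TensorProduct.assoc k B B B).symm (b ⊗ₜ Coalgebra.comul (R := k) c) := rfl

/-- `Δ` and the associator are algebra maps. This makes the diagonal action left colinear;
`comulRight_mul` plays the same role on the right. -/
theorem cofreeCoact_mul (s t : B ⊗[k] B) :
    cofreeCoact B B (s * t) = cofreeCoact B B s * cofreeCoact B B t := by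
  induction s with
  | zero => simp
  | add x y hx hy => simp only [add_mul, map_add, hx, hy]
  | tmul a b =>
    induction t with
    | zero => simp
    | add x y hx hy => simp only [mul_add, map_add, hx, hy]
    | tmul c d =>
      simp only [cofreeCoact, LinearMap.comp_apply, LinearEquiv.coe_coe, LinearMap.rTensor_tmul,
        Algebra.TensorProduct.tmul_mul_tmul, Bialgebra.comul_mul]
      rw [← Algebra.TensorProduct.tmul_mul_tmul]
      exact map_mul (Algebra.TensorProduct.assoc k k k B B B) _ _

theorem comulRight_mul (s t : B ⊗[k] B) :
    comulRight k B (s * t) = comulRight k B s * comulRight k B t := by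
  induction s with
  | zero => simp
  | add x y hx hy => simp only [add_mul, map_add, hx, hy]
  | tmul a b =>
    induction t with
    | zero => simp
    | add x y hx hy => simp only [mul_add, map_add, hx, hy]
    | tmul c d =>
      simp only [comulRight_tmul, Algebra.TensorProduct.tmul_mul_tmul, Bialgebra.comul_mul]
      rw [← Algebra.TensorProduct.tmul_mul_tmul]
      exact map_mul (Algebra.TensorProduct.assoc k k k B B B).symm _ _

theorem lTensor_diagAct_mulLeft (s : B ⊗[k] B) (y : B ⊗[k] (B ⊗[k] B)) :
    (diagAct k B).lTensor B (mulLeft k B B (B ⊗[k] B) (s ⊗ₜ y)) =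
      (Coalgebra.comul (R := k) (A := B)).lTensor B s * y := by
  induction s with
  | zero => simp
  | add x y hx hy => simp only [TensorProduct.add_tmul, map_add, add_mul, hx, hy]
  | tmul a b =>
    induction y with
    | zero => simp
    | add x y hx hy => simp only [TensorProduct.tmul_add, map_add, mul_add, hx, hy]
    | tmul c t => simp

theorem rTensor_diagAct_mulRight (s : B ⊗[k] B) (y : (B ⊗[k] B) ⊗[k] B) :
    (diagAct k B).rTensor B (mulRight k B B (B ⊗[k] B) (s ⊗ₜ y)) =
      (Coalgebra.comul (R := k) (A := B)).rTensor B s * y := by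
  induction s with
  | zero => simp
  | add x y hx hy => simp only [TensorProduct.add_tmul, map_add, add_mul, hx, hy]
  | tmul a b =>
    induction y with
    | zero => simp
    | add x y hx hy => simp only [TensorProduct.tmul_add, map_add, mul_add, hx, hy]
    | tmul t c => simp

theorem isRightCoaction_comulRight : IsRightCoaction (comulRight k B) where
  coassoc := by
    refine TensorProduct.ext' fun b c => ?_
    simp only [LinearMap.comp_apply, LinearEquiv.coe_coe, comulRight_tmul]
    have h₁ (s : B ⊗[k] B) : TensorProduct.assoc k (B ⊗[k] B) B B ((comulRight k B).rTensor B
        ((TensorProduct.assoc k B B B).symm (b ⊗ₜ s))) =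
        (TensorProduct.assoc k B B (B ⊗[k] B)).symm (b ⊗ₜ TensorProduct.assoc k B B B
          ((Coalgebra.comul (R := k) (A := B)).rTensor B s)) := by
      induction s with
      | zero => simp
      | add x y hx hy => simp only [TensorProduct.tmul_add, map_add, hx, hy]
      | tmul p q =>
        simp only [TensorProduct.assoc_symm_tmul, LinearMap.rTensor_tmul, comulRight_tmul]
        generalize Coalgebra.comul (R := k) p = r
        induction r with
        | zero => simp
        | add x y hx hy => simp only [TensorProduct.add_tmul, TensorProduct.tmul_add, map_add, hx, hy]
        | tmul p q => simp
    have h₂ (s : B ⊗[k] B) : (Coalgebra.comul (R := k) (A := B)).lTensor (B ⊗[k] B)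
        ((TensorProduct.assoc k B B B).symm (b ⊗ₜ s)) =
        (TensorProduct.assoc k B B (B ⊗[k] B)).symm
          (b ⊗ₜ (Coalgebra.comul (R := k) (A := B)).lTensor B s) := by
      induction s with
      | zero => simp
      | add x y hx hy => simp only [TensorProduct.tmul_add, map_add, hx, hy]
      | tmul p q => simp
    rw [h₁, h₂, Coalgebra.coassoc_apply]
  counit := by
    refine TensorProduct.ext' fun b c => ?_
    simp only [LinearMap.comp_apply, comulRight_tmul]
    have h (s : B ⊗[k] B) : (Coalgebra.counit (R := k) (A := B)).lTensor (B ⊗[k] B)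
        ((TensorProduct.assoc k B B B).symm (b ⊗ₜ s)) =
        (TensorProduct.assoc k B B k).symm
          (b ⊗ₜ (Coalgebra.counit (R := k) (A := B)).lTensor B s) := by
      induction s with
      | zero => simp
      | add x y hx hy => simp only [TensorProduct.tmul_add, map_add, hx, hy]
      | tmul p q => simp
    rw [h, Coalgebra.lTensor_counit_comul]
    simp

variable (k B) in
/-- The Hopf trimodule `B ⊗ B` with the diagonal action, the left coaction on the first factor, and
the right coaction on the second factor. -/
def diagTrimod : Trimod k B where
  V := ModuleCat.of k (B ⊗[k] B)
  lcoact := cofreeCoact B B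
  rcoact := comulRight k B
  act := diagAct k B
  isLeftCoaction := isLeftCoaction_cofreeCoact B
  isRightCoaction := isRightCoaction_comulRight
  bicomodule := by
    refine TensorProduct.ext' fun b c => ?_
    -- The coactions live on different factors: both composites are `Δ(b) ⊗ Δ(c)` up to bracketing.
    have h₁ (s : B ⊗[k] B) : (comulRight k B).lTensor B (TensorProduct.assoc k B B B (s ⊗ₜ c)) =
        TensorProduct.assoc k B (B ⊗[k] B) B ((TensorProduct.assoc k B B B).toLinearMap.rTensor B
          ((TensorProduct.assoc k (B ⊗[k] B) B B).symm (s ⊗ₜ Coalgebra.comul (R := k) c))) := by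
      generalize hr : Coalgebra.comul (R := k) c = r
      induction s with
      | zero => simp
      | add x y hx hy => simp only [TensorProduct.add_tmul, map_add, hx, hy]
      | tmul p q =>
        simp only [TensorProduct.assoc_tmul, LinearMap.lTensor_tmul, comulRight_tmul, hr]
        clear hr
        induction r with
        | zero => simp
        | add x y hx hy => simp only [TensorProduct.tmul_add, map_add, hx, hy]
        | tmul r t => simp
    have h₂ (r : B ⊗[k] B) : (cofreeCoact B B).rTensor B
        ((TensorProduct.assoc k B B B).symm (b ⊗ₜ r)) =
        (TensorProduct.assoc k B B B).toLinearMap.rTensor B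
          ((TensorProduct.assoc k (B ⊗[k] B) B B).symm (Coalgebra.comul (R := k) b ⊗ₜ r)) := by
      induction r with
      | zero => simp
      | add x y hx hy => simp only [TensorProduct.tmul_add, map_add, hx, hy]
      | tmul r t => simp [cofreeCoact]
    refine (h₁ (Coalgebra.comul (R := k) b)).trans ?_
    rw [← h₂]
    rfl
  one_act x := by
    change Coalgebra.comul (R := k) (1 : B) * x = x
    rw [Bialgebra.comul_one, one_mul]
  mul_act a b x := by
    change Coalgebra.comul (R := k) (a * b) * x =
      Coalgebra.comul (R := k) a * (Coalgebra.comul (R := k) b * x)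
    rw [Bialgebra.comul_mul, mul_assoc]
  lcoact_act := by
    -- Both sides multiply the coaction of `t` by an iterated coproduct of `a`, and coassociativity
    -- identifies the two.
    refine TensorProduct.ext' fun a t => ?_
    refine (cofreeCoact_mul _ t).trans ?_
    refine Eq.trans ?_ (lTensor_diagAct_mulLeft (Coalgebra.comul (R := k) a)
      (cofreeCoact B B t)).symm
    rw [← Coalgebra.coassoc_apply]
    rfl
  rcoact_act := by
    refine TensorProduct.ext' fun a t => ?_
    refine (comulRight_mul _ t).trans ?_
    refine Eq.trans ?_ (rTensor_diagAct_mulRight (Coalgebra.comul (R := k) a)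
      (comulRight k B t)).symm
    rw [← Coalgebra.coassoc_symm_apply]
    rfl

/-- The coinvariants of `B ⊗ B` are `B ⊗ 1`. -/
theorem eq_tmul_one_of_comulRight {t : B ⊗[k] B} (h : comulRight k B t = t ⊗ₜ[k] 1) :
    t = TensorProduct.rid k B ((Coalgebra.counit (R := k) (A := B)).lTensor B t) ⊗ₜ[k] 1 := by
  -- Applying the counit to the middle leg of the coaction returns the element; on a coinvariant
  -- this exhibits the form `b ⊗ 1`.
  have e (s : B ⊗[k] B) : ((TensorProduct.rid k B).toLinearMap ∘ₗ
      (Coalgebra.counit (R := k) (A := B)).lTensor B).rTensor B (comulRight k B s) = s := by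
    induction s with
    | zero => simp
    | add x y hx hy => simp only [map_add, hx, hy]
    | tmul b c =>
      have h' (s : B ⊗[k] B) : ((TensorProduct.rid k B).toLinearMap ∘ₗ
          (Coalgebra.counit (R := k) (A := B)).lTensor B).rTensor B
            ((TensorProduct.assoc k B B B).symm (b ⊗ₜ s)) =
          b ⊗ₜ TensorProduct.lid k B ((Coalgebra.counit (R := k) (A := B)).rTensor B s) := by
        induction s with
        | zero => simp
        | add x y hx hy => simp only [TensorProduct.tmul_add, map_add, hx, hy]
        | tmul p q => simp [TensorProduct.smul_tmul]
      rw [comulRight_tmul, h', Coalgebra.rTensor_counit_comul]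
      simp
  have h' := e t
  rw [h] at h'
  exact h'.symm

theorem Trimod.bijective_of_iso {X Y : Trimod k B} (e : X ≅ Y) :
    Function.Bijective (Trimod.Hom.toLin e.hom) := by
  refine Function.bijective_iff_has_inverse.2 ⟨(Trimod.Hom.toLin e.inv), fun x => ?_, fun x => ?_⟩
  · exact LinearMap.congr_fun (congrArg Trimod.Hom.toLin e.hom_inv_id) x
  · exact LinearMap.congr_fun (congrArg Trimod.Hom.toLin e.inv_hom_id) x

theorem freeRcoact_one_tmul {M : Type u} [AddCommGroup M] [Module k M] (m : M) :
    Trimod.freeRcoact B M ((1 : B) ⊗ₜ[k] m) = (1 ⊗ₜ[k] m) ⊗ₜ[k] 1 := by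
  rw [Trimod.freeRcoact_tmul, Bialgebra.comul_one, Algebra.TensorProduct.one_def]
  simp

/-- An isomorphism matches the coinvariants `1 ⊗ M` and `B ⊗ 1`, giving `ψ : M → B`. By linearity
over `B` it is then the Galois map after `id ⊗ ψ`. -/
theorem bijective_galois_of_iso {M : LeftComod k B} (e : Trimod.free M ≅ diagTrimod k B) :
    Function.Bijective (galois k B) := by
  let φ : B ⊗[k] M.V →ₗ[k] B ⊗[k] B := Trimod.Hom.toLin e.hom
  have hφ : Function.Bijective φ := Trimod.bijective_of_iso e
  have hr (x : B ⊗[k] M.V) : comulRight k B (φ x) = φ.rTensor B (Trimod.freeRcoact B M.V x) :=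
    LinearMap.congr_fun (Trimod.Hom.rcomm e.hom) x
  have ha (b : B) (x : B ⊗[k] M.V) : φ (Trimod.freeAct B M.V (b ⊗ₜ x)) =
      Coalgebra.comul (R := k) b * φ x :=
    LinearMap.congr_fun (Trimod.Hom.act_comm e.hom) (b ⊗ₜ x)
  let p : B ⊗[k] B →ₗ[k] B :=
    (TensorProduct.rid k B).toLinearMap ∘ₗ (Coalgebra.counit (R := k) (A := B)).lTensor B
  let ψ : M.V →ₗ[k] B := p ∘ₗ φ ∘ₗ TensorProduct.mk k B M.V 1
  have hψ (m : M.V) : φ (1 ⊗ₜ m) = ψ m ⊗ₜ 1 := by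
    refine eq_tmul_one_of_comulRight ?_
    rw [hr, freeRcoact_one_tmul, LinearMap.rTensor_tmul]
  have h : φ = galois k B ∘ₗ ψ.lTensor B := by
    refine TensorProduct.ext' fun b m => ?_
    have h₁ := ha b (1 ⊗ₜ m)
    rw [Trimod.freeAct_tmul, mul_one, hψ] at h₁
    exact h₁
  -- The preimage of `c ⊗ 1` is coinvariant because `φ ⊗ id` is injective, hence it lies in `1 ⊗ M`.
  have hs : Function.Surjective ψ := by
    intro c
    obtain ⟨x, hx⟩ := hφ.2 (c ⊗ₜ 1)
    have h₁ : Trimod.freeRcoact B M.V x = x ⊗ₜ 1 := by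
      apply Module.Flat.rTensor_preserves_injective_linearMap (M := B) φ hφ.1
      rw [← hr, hx, comulRight_tmul, Bialgebra.comul_one, Algebra.TensorProduct.one_def]
      simp [hx]
    refine ⟨contractLeft M.V Coalgebra.counit x, ?_⟩
    have h₂ := hψ (contractLeft M.V Coalgebra.counit x)
    rw [← eq_one_tmul_of_freeRcoact h₁, hx] at h₂
    simpa [p] using (congrArg p h₂).symm
  have hs' : Function.Surjective (ψ.lTensor B) := LinearMap.lTensor_surjective B hs
  have h₁ : Function.Bijective (galois k B ∘ ψ.lTensor B) := by
    have := hφ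
    rw [h] at this
    exact this
  -- The composite with the surjection `id ⊗ ψ` is bijective, which forces the Galois map itself to
  -- be bijective.
  refine ⟨fun x y hxy => ?_, Function.Surjective.of_comp h₁.2⟩
  obtain ⟨x, rfl⟩ := hs' x
  obtain ⟨y, rfl⟩ := hs' y
  rw [h₁.1 hxy]

theorem hasTwistedAntipode_of_isEquivalence (h : (freeTrimod k B).IsEquivalence) :
    HasTwistedAntipode k B := by
  obtain ⟨M, ⟨e⟩⟩ := Functor.EssSurj.mem_essImage (F := freeTrimod k B) (diagTrimod k B)
  exact hasTwistedAntipode_of_bijective (bijective_galois_of_iso e)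

end Diagonal

/-! ### The structure theorem for Hopf trimodules -/

section Structure

variable {k : Type u} [Field k] {B : Type u} [Ring B] [Bialgebra k B]

/-! ### Comatrices and twisted antipodes -/

section Matrix

variable {n : Type} [Fintype n] [DecidableEq n] {T : B →ₗ[k] B} {c : Matrix n n B}

/-- The identity `T(b₍₂₎) b₍₁₎ = ε(b)` at `b = c i j` is the entry `(j, i)`. The transposes record
the reversed order of the legs and cannot be pulled out, as `B` need not be commutative. -/
theorem transpose_map_mul_transpose
    (hT : ∀ b : B, LinearMap.mul' k B (T.rTensor B
      (TensorProduct.comm k B B (Coalgebra.comul b))) = algebraMap k B (Coalgebra.counit b))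
    (hc : IsComatrix k c) : (c.map T).transpose * c.transpose = 1 := by
  ext j i
  have h := hT (c i j)
  rw [hc.comul, hc.counit] at h
  simp only [map_sum, TensorProduct.comm_tmul, LinearMap.rTensor_tmul, LinearMap.mul'_apply] at h
  rw [Matrix.mul_apply]
  simp only [Matrix.transpose_apply, Matrix.map_apply]
  rw [h, Matrix.one_apply, Matrix.one_apply]
  rcases eq_or_ne i j with rfl | hij
  · simp
  · simp [hij, hij.symm]

theorem transpose_mul_transpose_map
    (hT : ∀ b : B, LinearMap.mul' k B (T.lTensor B
      (TensorProduct.comm k B B (Coalgebra.comul b))) = algebraMap k B (Coalgebra.counit b))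
    (hc : IsComatrix k c) : c.transpose * (c.map T).transpose = 1 := by
  ext j i
  have h := hT (c i j)
  rw [hc.comul, hc.counit] at h
  simp only [map_sum, TensorProduct.comm_tmul, LinearMap.lTensor_tmul, LinearMap.mul'_apply] at h
  rw [Matrix.mul_apply]
  simp only [Matrix.transpose_apply, Matrix.map_apply]
  rw [h, Matrix.one_apply, Matrix.one_apply]
  rcases eq_or_ne i j with rfl | hij
  · simp
  · simp [hij, hij.symm]

/-- An inverse `E` of the transpose of a comatrix is a comatrix. -/
theorem IsComatrix.of_inverse {E : Matrix n n B} (hc : IsComatrix k c)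
    (h₁ : E * c.transpose = 1) (h₂ : c.transpose * E = 1) : IsComatrix k E where
  comul := by
    let δ := (Bialgebra.comulAlgHom k B).mapMatrix (m := n)
    let l := (Algebra.TensorProduct.includeLeft (R := k) (S := k) (A := B) (B := B)).mapMatrix
      (m := n)
    let r := (Algebra.TensorProduct.includeRight (R := k) (A := B) (B := B)).mapMatrix (m := n)
    -- With `l` and `r` embedding `B` into the two legs of `B ⊗ B`, transposing the comatrix law
    -- reverses the order of its factors.
    have hδ : δ c.transpose = r c.transpose * l c.transpose := by
      ext j i
      rw [Matrix.mul_apply]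
      refine (hc.comul i j).trans (Finset.sum_congr rfl fun m _ => ?_)
      simp [r, l]
    -- Both sides are inverse to `δ c.transpose`, one from the right and one from the left;
    -- inverting restores the order of the factors.
    have h : δ E = l E * r E := by
      have e₁ : l E * r E * δ c.transpose = 1 := by
        rw [hδ, mul_assoc, ← mul_assoc (r E), ← map_mul, h₁, map_one, one_mul, ← map_mul, h₁,
          map_one]
      have e₂ : δ c.transpose * δ E = 1 := by rw [← map_mul, h₂, map_one]
      exact (left_inv_eq_right_inv e₁ e₂).symm
    intro i j
    have e := congrFun (congrFun h i) j
    rw [Matrix.mul_apply] at e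
    refine e.trans (Finset.sum_congr rfl fun m _ => ?_)
    simp [r, l]
  counit := by
    let ε := (Bialgebra.counitAlgHom k B).mapMatrix (m := n)
    have hε : ε c.transpose = 1 := by
      rw [← Matrix.transpose_one]
      ext j i
      exact hc.counit i j
    have h : ε E = 1 := by
      calc ε E = ε E * ε c.transpose := by rw [hε, mul_one]
        _ = 1 := by rw [← map_mul, h₁, map_one]
    intro i j
    exact congrFun (congrFun h i) j

end Matrix

/-- A twisted antipode is an antihomomorphism of coalgebras. -/
theorem comul_twistedAntipode {T : B →ₗ[k] B}
    (h₁ : ∀ b : B, LinearMap.mul' k B (T.rTensor B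
      (TensorProduct.comm k B B (Coalgebra.comul b))) = algebraMap k B (Coalgebra.counit b))
    (h₂ : ∀ b : B, LinearMap.mul' k B (T.lTensor B
      (TensorProduct.comm k B B (Coalgebra.comul b))) = algebraMap k B (Coalgebra.counit b))
    (b : B) : Coalgebra.comul (R := k) (T b) =
      TensorProduct.map T T (TensorProduct.comm k B B (Coalgebra.comul b)) := by
  -- By linearity it suffices to treat comatrix entries, where the claim is the comatrix law for the
  -- transpose of `T(c)`.
  obtain ⟨d, c, a, hc, rfl⟩ := exists_comatrix (k := k) b
  have hE := hc.of_inverse (transpose_map_mul_transpose h₁ hc) (transpose_mul_transpose_map h₂ hc)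
  simp only [map_sum, map_smul]
  refine Finset.sum_congr rfl fun i _ => Finset.sum_congr rfl fun j _ => ?_
  congr 1
  refine (hE.comul j i).trans ?_
  rw [hc.comul]
  simp

namespace Trimod

/-- A linear isomorphism which is a morphism of Hopf trimodules is an isomorphism. -/
theorem isIso_of_bijective {X Y : Trimod k B} (f : X ⟶ Y)
    (hf : Function.Bijective (Hom.toLin f)) : IsIso f := by
  let e : X.V ≃ₗ[k] Y.V := LinearEquiv.ofBijective (Hom.toLin f) hf
  have he : Hom.toLin f = e.toLinearMap := rfl
  have hl : (Hom.toLin f) ∘ₗ e.symm.toLinearMap = LinearMap.id := by simp [he]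
  have hr : e.symm.toLinearMap ∘ₗ (Hom.toLin f) = LinearMap.id := by simp [he]
  have hL : e.symm.toLinearMap.lTensor B ∘ₗ (Hom.toLin f).lTensor B = LinearMap.id := by
    rw [← LinearMap.lTensor_comp, hr, LinearMap.lTensor_id]
  have hL' : (Hom.toLin f).lTensor B ∘ₗ e.symm.toLinearMap.lTensor B = LinearMap.id := by
    rw [← LinearMap.lTensor_comp, hl, LinearMap.lTensor_id]
  have hR : e.symm.toLinearMap.rTensor B ∘ₗ (Hom.toLin f).rTensor B = LinearMap.id := by
    rw [← LinearMap.rTensor_comp, hr, LinearMap.rTensor_id]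
  let g : Y ⟶ X :=
    { toLin := e.symm.toLinearMap
      lcomm := by
        rw [← LinearMap.id_comp (X.lcoact ∘ₗ _), ← hL, LinearMap.comp_assoc,
          ← LinearMap.comp_assoc _ X.lcoact, ← f.lcomm, LinearMap.comp_assoc, hl,
          LinearMap.comp_id]
      rcomm := by
        rw [← LinearMap.id_comp (X.rcoact ∘ₗ _), ← hR, LinearMap.comp_assoc,
          ← LinearMap.comp_assoc _ X.rcoact, ← f.rcomm, LinearMap.comp_assoc, hl,
          LinearMap.comp_id]
      act_comm := by
        rw [← LinearMap.comp_id (e.symm.toLinearMap ∘ₗ Y.act), ← hL', LinearMap.comp_assoc,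
          ← LinearMap.comp_assoc _ _ Y.act, ← f.act_comm, ← LinearMap.comp_assoc,
          ← LinearMap.comp_assoc, hr, LinearMap.id_comp] }
  exact ⟨g, hom_ext hr, hom_ext hl⟩

/-! ### Right coinvariants and the projection onto them -/

variable (X : Trimod k B) (T : B →ₗ[k] B)

/-- The subspace of right coinvariants. -/
def coinvariants : Submodule k X.V :=
  LinearMap.ker (X.rcoact - (TensorProduct.mk k X.V B).flip 1)

theorem mem_coinvariants {x : X.V} : x ∈ X.coinvariants ↔ X.rcoact x = x ⊗ₜ 1 := by
  simp [coinvariants, sub_eq_zero]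

/-- The map `x ⊗ b ↦ T(b) x`. -/
def twist : X.V ⊗[k] B →ₗ[k] X.V :=
  X.act ∘ₗ (TensorProduct.comm k X.V B).toLinearMap ∘ₗ T.lTensor X.V

@[simp]
theorem twist_tmul (x : X.V) (b : B) : X.twist T (x ⊗ₜ b) = X.act (T b ⊗ₜ x) := rfl

theorem act_counit_smul (a : k) (x : X.V) : X.act (algebraMap k B a ⊗ₜ[k] x) = a • x := by
  rw [Algebra.algebraMap_eq_smul_one, ← TensorProduct.smul_tmul', map_smul, X.one_act]

theorem rcoact_act_apply (b : B) (x : X.V) : X.rcoact (X.act (b ⊗ₜ x)) =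
    X.act.rTensor B (mulRight k B B X.V (Coalgebra.comul (R := k) b ⊗ₜ X.rcoact x)) :=
  LinearMap.congr_fun X.rcoact_act (b ⊗ₜ x)

theorem lcoact_act_apply (b : B) (x : X.V) : X.lcoact (X.act (b ⊗ₜ x)) =
    X.act.lTensor B (mulLeft k B B X.V (Coalgebra.comul (R := k) b ⊗ₜ X.lcoact x)) :=
  LinearMap.congr_fun X.lcoact_act (b ⊗ₜ x)

theorem rcoact_coassoc (x : X.V) : X.rcoact.rTensor B (X.rcoact x) =
    (TensorProduct.assoc k X.V B B).symm
      ((Coalgebra.comul (R := k) (A := B)).lTensor X.V (X.rcoact x)) := by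
  rw [LinearEquiv.eq_symm_apply]
  exact LinearMap.congr_fun X.isRightCoaction.coassoc x

theorem rcoact_counit (x : X.V) : TensorProduct.rid k X.V
    ((Coalgebra.counit (R := k) (A := B)).lTensor X.V (X.rcoact x)) = x := by
  have h := LinearMap.congr_fun X.isRightCoaction.counit x
  simp only [LinearMap.comp_apply] at h
  rw [h]
  simp

variable {T}
variable (h₁ : ∀ b : B, LinearMap.mul' k B (T.rTensor B
    (TensorProduct.comm k B B (Coalgebra.comul b))) = algebraMap k B (Coalgebra.counit b))
  (h₂ : ∀ b : B, LinearMap.mul' k B (T.lTensor B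
    (TensorProduct.comm k B B (Coalgebra.comul b))) = algebraMap k B (Coalgebra.counit b))

include h₁ in
theorem twistedAntipode_one : T 1 = 1 := by
  have h := h₁ 1
  rw [Bialgebra.comul_one, Algebra.TensorProduct.one_def] at h
  simpa using h

include h₁ h₂ in
/-- `T(x₍₁₎) x₍₀₎` is coinvariant. -/
theorem rcoact_twist_rcoact (x : X.V) :
    X.rcoact (X.twist T (X.rcoact x)) = X.twist T (X.rcoact x) ⊗ₜ[k] 1 := by
  -- As `T` reverses coproducts, the coaction of `T(b) y` is `T(b₍₂₎) y₍₀₎ ⊗ T(b₍₁₎) y₍₁₎`; `N` is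
  -- the multilinear shape of this formula.
  let N : (X.V ⊗[k] B) ⊗[k] (B ⊗[k] B) →ₗ[k] X.V ⊗[k] B :=
    X.act.rTensor B ∘ₗ mulRight k B B X.V ∘ₗ
      (TensorProduct.map T T ∘ₗ (TensorProduct.comm k B B).toLinearMap).rTensor (X.V ⊗[k] B) ∘ₗ
      (TensorProduct.comm k (X.V ⊗[k] B) (B ⊗[k] B)).toLinearMap
  have hN (y : X.V) (p q r : B) :
      N ((y ⊗ₜ p) ⊗ₜ (q ⊗ₜ r)) = X.act (T r ⊗ₜ y) ⊗ₜ (T q * p) := by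
    simp [N]
  have e₁ (t : X.V ⊗[k] B) : X.rcoact (X.twist T t) =
      N ((Coalgebra.comul (R := k) (A := B)).lTensor (X.V ⊗[k] B) (X.rcoact.rTensor B t)) := by
    induction t with
    | zero => simp
    | add x y hx hy => simp only [map_add, hx, hy]
    | tmul y b =>
      rw [twist_tmul, rcoact_act_apply, comul_twistedAntipode h₁ h₂]
      rfl
  -- The value is `T(b₍₃₎) y ⊗ T(b₍₂₎) b₍₁₎`. Rebracketing (`f₁`) groups the first two legs of the
  -- coproduct, and the antipode identity (`f₂`) cancels them.
  have e₂ (y : X.V) (b : B) : N ((Coalgebra.comul (R := k) (A := B)).lTensor (X.V ⊗[k] B)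
      ((TensorProduct.assoc k X.V B B).symm (y ⊗ₜ Coalgebra.comul (R := k) b))) =
      X.act (T b ⊗ₜ y) ⊗ₜ 1 := by
    have f₁ (s : B ⊗[k] B) : N ((Coalgebra.comul (R := k) (A := B)).lTensor (X.V ⊗[k] B)
        ((TensorProduct.assoc k X.V B B).symm (y ⊗ₜ s))) =
        N (TensorProduct.assoc k (X.V ⊗[k] B) B B
          ((TensorProduct.assoc k X.V B B).symm.toLinearMap.rTensor B
            ((TensorProduct.assoc k X.V (B ⊗[k] B) B).symm (y ⊗ₜ
              (TensorProduct.assoc k B B B).symm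
                ((Coalgebra.comul (R := k) (A := B)).lTensor B s))))) := by
      induction s with
      | zero => simp
      | add x y hx hy => simp only [TensorProduct.tmul_add, map_add, hx, hy]
      | tmul p q =>
        simp only [LinearMap.lTensor_tmul, TensorProduct.assoc_symm_tmul]
        generalize Coalgebra.comul (R := k) q = r
        induction r with
        | zero => simp
        | add x y hx hy => simp only [TensorProduct.tmul_add, map_add, hx, hy]
        | tmul q r => simp
    have f₂ (s : B ⊗[k] B) : N (TensorProduct.assoc k (X.V ⊗[k] B) B B
          ((TensorProduct.assoc k X.V B B).symm.toLinearMap.rTensor B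
            ((TensorProduct.assoc k X.V (B ⊗[k] B) B).symm (y ⊗ₜ
              (Coalgebra.comul (R := k) (A := B)).rTensor B s)))) =
        X.act (T (TensorProduct.lid k B ((Coalgebra.counit (R := k) (A := B)).rTensor B s)) ⊗ₜ y)
          ⊗ₜ 1 := by
      induction s with
      | zero => simp
      | add x y hx hy =>
        simp only [TensorProduct.tmul_add, TensorProduct.add_tmul, map_add, hx, hy]
      | tmul p q =>
        have f₃ (r : B ⊗[k] B) : N (TensorProduct.assoc k (X.V ⊗[k] B) B B
            ((TensorProduct.assoc k X.V B B).symm.toLinearMap.rTensor B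
              ((TensorProduct.assoc k X.V (B ⊗[k] B) B).symm (y ⊗ₜ (r ⊗ₜ q))))) =
            X.act (T q ⊗ₜ y) ⊗ₜ
              LinearMap.mul' k B (T.rTensor B (TensorProduct.comm k B B r)) := by
          induction r with
          | zero => simp
          | add x y hx hy =>
            simp only [TensorProduct.tmul_add, TensorProduct.add_tmul, map_add, hx, hy]
          | tmul a b => simp [hN]
        rw [LinearMap.rTensor_tmul, f₃, h₁]
        simp only [Algebra.algebraMap_eq_smul_one, LinearMap.rTensor_tmul, TensorProduct.lid_tmul,
          map_smul, TensorProduct.tmul_smul]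
        rw [← TensorProduct.smul_tmul' (Coalgebra.counit (R := k) p) (T q) y, map_smul,
          TensorProduct.smul_tmul']
    rw [f₁, Coalgebra.coassoc_symm_apply, f₂, Coalgebra.rTensor_counit_comul]
    simp
  rw [e₁, rcoact_coassoc]
  generalize X.rcoact x = t
  induction t with
  | zero => simp
  | add x y hx hy => simp only [TensorProduct.add_tmul, map_add, hx, hy]
  | tmul y b =>
    rw [LinearMap.lTensor_tmul, e₂, twist_tmul]

include h₂ in
/-- `x₍₂₎ T(x₍₁₎) x₍₀₎ = x`. -/
theorem act_twist_rcoact (x : X.V) :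
    X.act ((X.twist T ∘ₗ X.rcoact).lTensor B (TensorProduct.comm k X.V B (X.rcoact x))) = x := by
  have e₁ (t : X.V ⊗[k] B) : X.act ((X.twist T ∘ₗ X.rcoact).lTensor B
      (TensorProduct.comm k X.V B t)) =
      X.act ((X.twist T).lTensor B (TensorProduct.comm k (X.V ⊗[k] B) B
        (X.rcoact.rTensor B t))) := by
    induction t with
    | zero => simp
    | add x y hx hy => simp only [map_add, hx, hy]
    | tmul y b => simp
  rw [e₁, rcoact_coassoc]
  -- This makes both sides linear in the coaction of `x`, which can then be replaced by an arbitrary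
  -- tensor.
  conv_rhs => rw [← X.rcoact_counit x]
  generalize X.rcoact x = t
  induction t with
  | zero => simp
  | add x y hx hy => simp only [map_add, hx, hy]
  | tmul y b =>
    have e₂ (s : B ⊗[k] B) : X.act ((X.twist T).lTensor B (TensorProduct.comm k (X.V ⊗[k] B) B
        ((TensorProduct.assoc k X.V B B).symm (y ⊗ₜ s)))) =
        X.act (LinearMap.mul' k B (T.lTensor B (TensorProduct.comm k B B s)) ⊗ₜ y) := by
      induction s with
      | zero => simp
      | add x y hx hy =>
        simp only [TensorProduct.tmul_add, TensorProduct.add_tmul, map_add, hx, hy]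
      | tmul p q => simp [X.mul_act]
    rw [LinearMap.lTensor_tmul, e₂, h₂, act_counit_smul]
    simp

include h₁ in
/-- `T((b y)₍₁₎) (b y)₍₀₎ = ε(b) y` if `y` is coinvariant. -/
theorem twist_rcoact_act {y : X.V} (hy : y ∈ X.coinvariants) (b : B) :
    X.twist T (X.rcoact (X.act (b ⊗ₜ y))) = Coalgebra.counit (R := k) b • y := by
  have e (s : B ⊗[k] B) : X.twist T (X.act.rTensor B (mulRight k B B X.V (s ⊗ₜ (y ⊗ₜ 1)))) =
      X.act (LinearMap.mul' k B (T.rTensor B (TensorProduct.comm k B B s)) ⊗ₜ y) := by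
    induction s with
    | zero => simp
    | add x y hx hy => simp only [TensorProduct.add_tmul, map_add, hx, hy]
    | tmul p q => simp [X.mul_act]
  rw [rcoact_act_apply, X.mem_coinvariants.1 hy, e, h₁, act_counit_smul]

include h₁ in
/-- The coinvariants are stable under the left coaction. -/
theorem lTensor_twist_lcoact {y : X.V} (hy : y ∈ X.coinvariants) :
    (X.twist T ∘ₗ X.rcoact).lTensor B (X.lcoact y) = X.lcoact y := by
  -- The bicomodule law turns the right coaction on the second leg of `X.lcoact y` into tensoring
  -- with `1`, and `T(1) = 1`.
  have h := LinearMap.congr_fun X.bicomodule y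
  simp only [LinearMap.comp_apply, LinearEquiv.coe_coe, X.mem_coinvariants.1 hy,
    LinearMap.rTensor_tmul] at h
  rw [LinearMap.lTensor_comp_apply, h]
  generalize X.lcoact y = t
  induction t with
  | zero => simp
  | add x y hx hy => simp only [TensorProduct.add_tmul, map_add, hx, hy]
  | tmul b x => simp [twistedAntipode_one h₁, X.one_act]

include h₁ h₂ in
-- The structure theorem: `b ⊗ w ↦ b w` from `B ⊗ W`, with `W` the coinvariants, has inverse `x ↦
-- x₍₂₎ ⊗ T(x₍₁₎) x₍₀₎`.
theorem exists_iso_free : ∃ M : LeftComod k B, Nonempty (free M ≅ X) := by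
  let W := X.coinvariants
  let P : X.V →ₗ[k] W := LinearMap.codRestrict W (X.twist T ∘ₗ X.rcoact) fun x =>
    X.mem_coinvariants.2 (X.rcoact_twist_rcoact h₁ h₂ x)
  have hP : X.twist T ∘ₗ X.rcoact = W.subtype ∘ₗ P := rfl
  -- The left coaction of `W` lands in `B ⊗ W`, so applying `P` to the second leg merely corestricts
  -- it.
  have hW (w : W) : W.subtype.lTensor B (P.lTensor B (X.lcoact w)) = X.lcoact w := by
    rw [← LinearMap.lTensor_comp_apply, ← hP]
    exact X.lTensor_twist_lcoact h₁ w.2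
  let M : LeftComod k B :=
    { V := ModuleCat.of k W
      coact := P.lTensor B ∘ₗ X.lcoact ∘ₗ W.subtype
      isLeftCoaction := X.isLeftCoaction.of_injective W.subtype W.subtype_injective hW }
  let θ : B ⊗[k] W →ₗ[k] X.V := X.act ∘ₗ W.subtype.lTensor B
  have hθ (b : B) (w : W) : θ (b ⊗ₜ w) = X.act (b ⊗ₜ (w : X.V)) := rfl
  let f : free M ⟶ X :=
    { toLin := θ
      lcomm := by
        refine TensorProduct.ext' fun b (w : W) => ?_
        refine (X.lcoact_act_apply b w).trans ?_
        have h := mulLeft_natural (LinearMap.id (R := k) (M := B)) W.subtype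
          (Coalgebra.comul (R := k) b) (P.lTensor B (X.lcoact w))
        rw [LinearMap.lTensor_id, LinearMap.id_apply, hW] at h
        rw [h, ← LinearMap.lTensor_comp_apply]
        rfl
      rcomm := by
        refine TensorProduct.ext' fun b (w : W) => ?_
        refine (X.rcoact_act_apply b w).trans ?_
        rw [X.mem_coinvariants.1 w.2]
        change _ = θ.rTensor B (TensorProduct.rightComm k B B W (Coalgebra.comul (R := k) b ⊗ₜ w))
        generalize Coalgebra.comul (R := k) b = s
        induction s with
        | zero => simp
        | add x y hx hy => simp only [TensorProduct.add_tmul, map_add, hx, hy]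
        | tmul p q => simp [hθ]
      act_comm := by
        refine TensorProduct.ext_threefold' fun a b (w : W) => ?_
        exact X.mul_act a b w }
  let σ : X.V →ₗ[k] B ⊗[k] W :=
    P.lTensor B ∘ₗ (TensorProduct.comm k X.V B).toLinearMap ∘ₗ X.rcoact
  have hθσ (x : X.V) : θ (σ x) = x := by
    have h := X.act_twist_rcoact h₂ x
    rw [hP, LinearMap.lTensor_comp_apply] at h
    exact h
  -- For coinvariant `w`, the right coaction of `b w` is `b₍₁₎ w ⊗ b₍₂₎`, and `P` sends `b₍₁₎ w` to
  -- `ε(b₍₁₎) w`.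
  have hσθ : σ ∘ₗ θ = LinearMap.id := by
    refine TensorProduct.ext' fun b w => ?_
    have e (s : B ⊗[k] B) : P.lTensor B (TensorProduct.comm k X.V B (X.act.rTensor B
        (mulRight k B B X.V (s ⊗ₜ ((w : X.V) ⊗ₜ 1))))) =
        (TensorProduct.lid k B ((Coalgebra.counit (R := k) (A := B)).rTensor B s)) ⊗ₜ w := by
      induction s with
      | zero => simp
      | add x y hx hy => simp only [TensorProduct.add_tmul, map_add, hx, hy]
      | tmul p q =>
        have h : P (X.act (p ⊗ₜ (w : X.V))) = Coalgebra.counit (R := k) p • w :=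
          Subtype.ext (X.twist_rcoact_act h₁ w.2 p)
        simp [h, TensorProduct.smul_tmul]
    change P.lTensor B (TensorProduct.comm k X.V B (X.rcoact (X.act (b ⊗ₜ (w : X.V))))) = b ⊗ₜ w
    rw [rcoact_act_apply, X.mem_coinvariants.1 w.2, e, Coalgebra.rTensor_counit_comul]
    simp
  have hf : IsIso f := isIso_of_bijective f (Function.bijective_iff_has_inverse.2
    ⟨σ, LinearMap.congr_fun hσθ, hθσ⟩)
  exact ⟨M, ⟨asIso f⟩⟩

end Trimod

/-! ### Full faithfulness of the free functor -/

theorem mulLeft_comul_one {M : Type u} [AddCommGroup M] [Module k M] (z : B ⊗[k] M) :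
    mulLeft k B B M (Coalgebra.comul (R := k) (1 : B) ⊗ₜ z) =
      (TensorProduct.mk k B M 1).lTensor B z := by
  rw [Bialgebra.comul_one, Algebra.TensorProduct.one_def]
  induction z with
  | zero => simp
  | add x y hx hy => simp only [TensorProduct.tmul_add, map_add, hx, hy]
  | tmul b m => simp

theorem contractLeft_counit_comp_mk (M : Type u) [AddCommGroup M] [Module k M] :
    contractLeft M (Coalgebra.counit (R := k) (A := B)) ∘ₗ TensorProduct.mk k B M 1 =
      LinearMap.id := by
  ext m; simp

instance : (freeTrimod k B).Faithful where
  map_injective {M N} f g h := by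
    refine LeftComod.hom_ext (LinearMap.ext fun m => ?_)
    have h' : f.toLin.lTensor B ((1 : B) ⊗ₜ[k] m) = g.toLin.lTensor B ((1 : B) ⊗ₜ[k] m) :=
      LinearMap.congr_fun (congrArg Trimod.Hom.toLin h) _
    simpa using congrArg (contractLeft N.V (Coalgebra.counit (R := k) (A := B))) h'

/-- A morphism preserves the coinvariants `1 ⊗ M`, hence restricts to some `ψ`, and `B`-linearity
makes it `id ⊗ ψ`. -/
instance : (freeTrimod k B).Full where
  map_surjective {M N} f := by
    let φ : B ⊗[k] M.V →ₗ[k] B ⊗[k] N.V := Trimod.Hom.toLin f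
    let c := contractLeft N.V (Coalgebra.counit (R := k) (A := B))
    let ψ : M.V →ₗ[k] N.V := c ∘ₗ φ ∘ₗ TensorProduct.mk k B M.V 1
    have hψ : φ ∘ₗ TensorProduct.mk k B M.V 1 = TensorProduct.mk k B N.V 1 ∘ₗ ψ := by
      refine LinearMap.ext fun m => ?_
      refine eq_one_tmul_of_freeRcoact ?_
      have h : Trimod.freeRcoact B N.V (φ (1 ⊗ₜ m)) =
          φ.rTensor B (Trimod.freeRcoact B M.V (1 ⊗ₜ m)) :=
        LinearMap.congr_fun f.rcomm ((1 : B) ⊗ₜ[k] m)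
      rw [freeRcoact_one_tmul, LinearMap.rTensor_tmul] at h
      exact h
    have hφ : φ = ψ.lTensor B := by
      refine TensorProduct.ext' fun b m => ?_
      have h : φ (Trimod.freeAct B M.V (b ⊗ₜ[k] ((1 : B) ⊗ₜ[k] m))) =
          Trimod.freeAct B N.V (b ⊗ₜ[k] φ ((1 : B) ⊗ₜ[k] m)) :=
        LinearMap.congr_fun f.act_comm (b ⊗ₜ[k] ((1 : B) ⊗ₜ[k] m))
      have h' : φ (1 ⊗ₜ m) = 1 ⊗ₜ ψ m := LinearMap.congr_fun hψ m
      rw [h', Trimod.freeAct_tmul, Trimod.freeAct_tmul, mul_one] at h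
      exact h
    refine ⟨⟨ψ, LinearMap.ext fun m => ?_⟩, Trimod.hom_ext hφ.symm⟩
    have h : mulLeft k B B N.V (Coalgebra.comul (R := k) (1 : B) ⊗ₜ N.coact (ψ m)) =
        φ.lTensor B (mulLeft k B B M.V (Coalgebra.comul (R := k) (1 : B) ⊗ₜ M.coact m)) := by
      have h' := LinearMap.congr_fun f.lcomm ((1 : B) ⊗ₜ[k] m)
      have e : φ (1 ⊗ₜ m) = 1 ⊗ₜ ψ m := LinearMap.congr_fun hψ m
      refine Eq.trans ?_ h'
      change _ = diagLeft Coalgebra.comul N.coact (φ (1 ⊗ₜ m))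
      rw [e, diagLeft_tmul]
    rw [mulLeft_comul_one, mulLeft_comul_one, ← LinearMap.lTensor_comp_apply, hψ,
      LinearMap.lTensor_comp_apply] at h
    -- Left colinearity at `1 ⊗ m` is colinearity of `ψ` with an extra `1` in the middle leg, which
    -- the counit removes.
    have h' := congrArg (c.lTensor B) h
    rw [← LinearMap.lTensor_comp_apply, ← LinearMap.lTensor_comp_apply,
      contractLeft_counit_comp_mk, LinearMap.lTensor_id] at h'
    exact h'

theorem isEquivalence_of_hasTwistedAntipode (h : HasTwistedAntipode k B) :
    (freeTrimod k B).IsEquivalence := by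
  obtain ⟨T, h₁, h₂⟩ := h
  exact { essSurj := ⟨fun X => X.exists_iso_free h₁ h₂⟩ }

end Structure

/-! ### Duals of finite-dimensional comodules -/

section Duals

variable {k : Type u} [Field k] {B : Type u} [Ring B] [Bialgebra k B]
variable {n : Type} [Fintype n]

/-- The coaction `e i ↦ ∑ j, c i j ⊗ e j` on `n → k`. -/
def comatrixCoact (c : Matrix n n B) : (n → k) →ₗ[k] B ⊗[k] (n → k) :=
  (Pi.basisFun k n).constr k fun i => ∑ j, c i j ⊗ₜ[k] Pi.basisFun k n j

theorem comatrixCoact_basis (c : Matrix n n B) (i : n) :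
    comatrixCoact (k := k) c (Pi.basisFun k n i) = ∑ j, c i j ⊗ₜ[k] Pi.basisFun k n j :=
  Module.Basis.constr_basis _ _ _ _

/-- Converse to `isComatrix_coeffMatrix`; it turns an inverse comatrix into the dual comodule. -/
theorem isLeftCoaction_comatrixCoact [DecidableEq n] {c : Matrix n n B} (hc : IsComatrix k c) :
    IsLeftCoaction (comatrixCoact (k := k) c) where
  coassoc := by
    refine (Pi.basisFun k n).ext fun i => ?_
    simp only [LinearMap.comp_apply, LinearEquiv.coe_coe]
    rw [comatrixCoact_basis]
    simp only [map_sum, LinearMap.rTensor_tmul, LinearMap.lTensor_tmul, hc.comul,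
      comatrixCoact_basis, TensorProduct.sum_tmul, TensorProduct.tmul_sum, TensorProduct.assoc_tmul]
    exact Finset.sum_comm
  counit := by
    refine (Pi.basisFun k n).ext fun i => ?_
    simp only [LinearMap.comp_apply]
    rw [comatrixCoact_basis]
    simp only [map_sum, LinearMap.rTensor_tmul, hc.counit, TensorProduct.mk_apply]
    rw [Finset.sum_eq_single i]
    · simp
    · intro j _ hj
      simp [Matrix.one_apply_ne hj.symm]
    · simp

section Pairing

variable {M : Type u} [AddCommGroup M] [Module k M] (e : Module.Basis n k M)

/-- The pairing of `n → k` with a vector space with basis `e` indexed by `n`. -/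
def basisPairing : (n → k) ⊗[k] M →ₗ[k] k :=
  TensorProduct.lift ((Pi.basisFun k n).constr k fun i => e.coord i)

theorem basisPairing_basis [DecidableEq n] (i j : n) :
    basisPairing e (Pi.basisFun k n i ⊗ₜ e j) = if j = i then 1 else 0 := by
  rw [basisPairing, TensorProduct.lift.tmul, Module.Basis.constr_basis, Module.Basis.coord_apply,
    Module.Basis.repr_self, Finsupp.single_apply]

/-- The element of `M ⊗ (n → k)` dual to `basisPairing`. -/
def basisCopairing : M ⊗[k] (n → k) := ∑ i, e i ⊗ₜ[k] Pi.basisFun k n i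

/-- The coevaluation is colinear once the matrix product here is `1`; `lTensor_basisPairing` gives
the opposite product for the evaluation. -/
theorem diagLeft_basisCopairing (f : M →ₗ[k] B ⊗[k] M) (E : Matrix n n B) :
    diagLeft f (comatrixCoact (k := k) E) (basisCopairing e) =
      ∑ j, ∑ l, ((coeffMatrix e f).transpose * E) j l ⊗ₜ[k] (e j ⊗ₜ[k] Pi.basisFun k n l) := by
  simp only [basisCopairing, map_sum, diagLeft_tmul, comatrixCoact_basis, coact_basis e f,
    TensorProduct.sum_tmul, TensorProduct.tmul_sum, mulLeft_tmul, Matrix.mul_apply,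
    Matrix.transpose_apply]
  exact Finset.sum_comm.trans
    (Eq.trans (Finset.sum_congr rfl fun _ _ => Finset.sum_comm) Finset.sum_comm)

variable [DecidableEq n]

theorem lTensor_basisPairing (f : M →ₗ[k] B ⊗[k] M) (E : Matrix n n B) (i j : n) :
    (basisPairing e).lTensor B
      (mulLeft k B (n → k) M (comatrixCoact (k := k) E (Pi.basisFun k n i) ⊗ₜ f (e j))) =
      (E * (coeffMatrix e f).transpose) i j ⊗ₜ[k] (1 : k) := by
  rw [comatrixCoact_basis, coact_basis e f j, Matrix.mul_apply]
  simp only [TensorProduct.sum_tmul, TensorProduct.tmul_sum, map_sum, mulLeft_tmul,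
    LinearMap.lTensor_tmul, basisPairing_basis, TensorProduct.tmul_ite,
    Finset.sum_ite_eq, Finset.mem_univ, if_true, Matrix.transpose_apply]

theorem map_basisPairing_basisCopairing (i : n) :
    TensorProduct.map (basisPairing e) LinearMap.id
      ((TensorProduct.assoc k (n → k) M (n → k)).symm
        (Pi.basisFun k n i ⊗ₜ[k] basisCopairing e)) = (1 : k) ⊗ₜ[k] Pi.basisFun k n i := by
  simp only [basisCopairing, TensorProduct.tmul_sum, map_sum, TensorProduct.assoc_symm_tmul,
    TensorProduct.map_tmul, basisPairing_basis, TensorProduct.ite_tmul,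
    Finset.sum_ite_eq', Finset.mem_univ, if_true, LinearMap.id_apply]

theorem map_basisCopairing_basisPairing (i : n) :
    TensorProduct.map LinearMap.id (basisPairing e)
      (TensorProduct.assoc k M (n → k) M (basisCopairing e ⊗ₜ[k] e i)) = e i ⊗ₜ[k] (1 : k) := by
  simp only [basisCopairing, TensorProduct.sum_tmul, map_sum, TensorProduct.assoc_tmul,
    TensorProduct.map_tmul, basisPairing_basis, TensorProduct.tmul_ite,
    Finset.sum_ite_eq, Finset.mem_univ, if_true, LinearMap.id_apply]

end Pairing

namespace LeftComod

variable [DecidableEq n]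

/-- The comodule `n → k` defined by a comatrix. -/
def ofComatrix {c : Matrix n n B} (hc : IsComatrix k c) : LeftComod k B where
  V := ModuleCat.of k (n → k)
  coact := comatrixCoact c
  isLeftCoaction := isLeftCoaction_comatrixCoact hc

variable {M : LeftComod k B} (e : Module.Basis n k M.V) {E : Matrix n n B}

/-- The evaluation of the dual comodule on `M`. -/
def dualEval (hE : IsComatrix k E) (h : E * (coeffMatrix e M.coact).transpose = 1) :
    ofComatrix hE ⊗ M ⟶ 𝟙_ (LeftComod k B) where
  toLin := basisPairing e
  comm := by
    refine TensorProduct.ext ((Pi.basisFun k n).ext fun i => e.ext fun j => ?_)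
    refine Eq.trans ?_ (lTensor_basisPairing e M.coact E i j).symm
    change (1 : B) ⊗ₜ[k] (basisPairing e (Pi.basisFun k n i ⊗ₜ[k] e j)) = _
    rw [h, basisPairing_basis, Matrix.one_apply]
    rcases eq_or_ne i j with rfl | hij
    · simp
    · simp [hij, hij.symm]

/-- The coevaluation of the dual comodule on `M`. -/
def dualCoeval (hE : IsComatrix k E) (h : (coeffMatrix e M.coact).transpose * E = 1) :
    𝟙_ (LeftComod k B) ⟶ M ⊗ ofComatrix hE where
  toLin := LinearMap.toSpanSingleton k (M.V ⊗[k] (n → k)) (basisCopairing e)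
  comm := by
    refine LinearMap.ext_ring ?_
    change diagLeft M.coact (comatrixCoact E)
      (LinearMap.toSpanSingleton k (M.V ⊗[k] (n → k)) (basisCopairing e) 1) =
      (1 : B) ⊗ₜ[k] (LinearMap.toSpanSingleton k (M.V ⊗[k] (n → k)) (basisCopairing e) 1)
    rw [LinearMap.toSpanSingleton_apply, one_smul, diagLeft_basisCopairing, h, basisCopairing,
      TensorProduct.tmul_sum]
    simp only [Matrix.one_apply, TensorProduct.ite_tmul,
      Finset.sum_ite_eq, Finset.mem_univ, if_true]

/-- A comodule with an invertible transposed coefficient matrix has a left dual. -/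
@[reducible]
def dualPairing (hE : IsComatrix k E) (h₁ : E * (coeffMatrix e M.coact).transpose = 1)
    (h₂ : (coeffMatrix e M.coact).transpose * E = 1) : ExactPairing M (ofComatrix hE) where
  coevaluation' := dualCoeval e hE h₂
  evaluation' := dualEval e hE h₁
  coevaluation_evaluation' := by
    refine hom_ext (TensorProduct.ext ((Pi.basisFun k n).ext fun i => LinearMap.ext_ring ?_))
    change TensorProduct.map (basisPairing e)
      LinearMap.id ((TensorProduct.assoc k (n → k) M.V (n → k)).symm (Pi.basisFun k n i ⊗ₜ[k]
        (LinearMap.toSpanSingleton k (M.V ⊗[k] (n → k)) (basisCopairing e) 1))) =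
      (1 : k) ⊗ₜ[k] TensorProduct.rid k (n → k) (Pi.basisFun k n i ⊗ₜ[k] (1 : k))
    rw [LinearMap.toSpanSingleton_apply, one_smul, map_basisPairing_basisCopairing,
      TensorProduct.rid_tmul, one_smul]
  evaluation_coevaluation' := by
    refine hom_ext (TensorProduct.ext (LinearMap.ext_ring (e.ext fun i => ?_)))
    change TensorProduct.map LinearMap.id (basisPairing e)
      (TensorProduct.assoc k M.V (n → k) M.V ((LinearMap.toSpanSingleton k (M.V ⊗[k] (n → k))
          (basisCopairing e) 1) ⊗ₜ[k] e i)) =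
      (TensorProduct.lid k M.V ((1 : k) ⊗ₜ[k] e i)) ⊗ₜ[k] (1 : k)
    rw [LinearMap.toSpanSingleton_apply, one_smul, map_basisCopairing_basisPairing,
      TensorProduct.lid_tmul, one_smul]

/-- The dual comodule has coefficient matrix the transpose of `T(c)`; the two axioms of `T` make
evaluation and coevaluation colinear. -/
theorem isLeftRigid_of_hasTwistedAntipode (h : HasTwistedAntipode k B) :
    IsLeftRigid (FinLeftComod k B) := by
  obtain ⟨T, h₁, h₂⟩ := h
  rintro ⟨M, hM⟩
  have : Module.Finite k M.V := hM
  let e := Module.finBasis k M.V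
  have hc := isComatrix_coeffMatrix e M.isLeftCoaction
  have hl := transpose_map_mul_transpose h₁ hc
  have hr := transpose_mul_transpose_map h₂ hc
  have hE := hc.of_inverse hl hr
  let Y : FinLeftComod k B := ⟨ofComatrix hE, inferInstanceAs (Module.Finite k (_ → k))⟩
  let _ : ExactPairing M (ofComatrix hE) := dualPairing e hE hl hr
  refine ⟨Y, ⟨{
    coevaluation' := ObjectProperty.homMk (η_ M (ofComatrix hE))
    evaluation' := ObjectProperty.homMk (ε_ M (ofComatrix hE))
    coevaluation_evaluation' := ObjectProperty.hom_ext _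
      (ExactPairing.coevaluation_evaluation M (ofComatrix hE))
    evaluation_coevaluation' := ObjectProperty.hom_ext _
      (ExactPairing.evaluation_coevaluation M (ofComatrix hE)) }⟩⟩

/-- A left dual in the category of finite-dimensional comodules is a left dual. -/
@[reducible]
def exactPairingOfFin (X Y : FinLeftComod k B) [ExactPairing X Y] :
    ExactPairing X.obj Y.obj where
  coevaluation' := (η_ X Y).hom
  evaluation' := (ε_ X Y).hom
  coevaluation_evaluation' :=
    congrArg InducedCategory.Hom.hom (ExactPairing.coevaluation_evaluation X Y)
  evaluation_coevaluation' :=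
    congrArg InducedCategory.Hom.hom (ExactPairing.evaluation_coevaluation X Y)

end LeftComod

end Duals

/-! ### Comodules as filtered colimits of finite-dimensional comodules -/

section FilteredColimit

variable {k : Type u} [Field k] {B : Type u} [Ring B] [Bialgebra k B]

namespace LeftComod

variable (M : LeftComod k B)

/-- The finite-dimensional subcomodules of a comodule. -/
abbrev FinSub : Type u :=
  {W : Submodule k M.V // Module.Finite k W ∧
    ∀ w : W, M.coact w ∈ LinearMap.range (W.subtype.lTensor B)}

variable {M} in
/-- The comodule defined by a finite-dimensional subcomodule. -/
def FinSub.comod (W : M.FinSub) : LeftComod k B :=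
  M.restrict W.1.subtype W.1.subtype_injective W.2.2

variable {M} in
/-- The inclusion of a finite-dimensional subcomodule. -/
def FinSub.incl (W : M.FinSub) : W.comod ⟶ M :=
  M.restrictHom W.1.subtype W.1.subtype_injective W.2.2

theorem range_lTensor_subtype_le {W W' : Submodule k M.V} (h : W ≤ W') :
    LinearMap.range (W.subtype.lTensor B) ≤ LinearMap.range (W'.subtype.lTensor B) := by
  rw [← Submodule.subtype_comp_inclusion W W' h, LinearMap.lTensor_comp]
  exact LinearMap.range_comp_le_range _ _

/-- The sum of two subcomodules is stable: the preimage of `B ⊗ (W + W')` under the coaction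
contains both. -/
instance : IsDirectedOrder M.FinSub where
  directed W W' := by
    refine ⟨⟨W.1 ⊔ W'.1, ?_, ?_⟩, (le_sup_left : W.1 ≤ W.1 ⊔ W'.1),
      (le_sup_right : W'.1 ≤ W.1 ⊔ W'.1)⟩
    · have := W.2.1
      have := W'.2.1
      exact Submodule.finite_sup _ _
    · let S := (LinearMap.range ((W.1 ⊔ W'.1).subtype.lTensor B)).comap M.coact
      have h : W.1 ⊔ W'.1 ≤ S := sup_le
        (fun w hw => M.range_lTensor_subtype_le le_sup_left (W.2.2 ⟨w, hw⟩))
        (fun w hw => M.range_lTensor_subtype_le le_sup_right (W'.2.2 ⟨w, hw⟩))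
      exact fun w => h w.2

/-- Every element of a comodule is contained in a finite-dimensional subcomodule. -/
theorem exists_mem_finSub (x : M.V) : ∃ W : M.FinSub, x ∈ W.1 :=
  ⟨⟨contractions (M.coact x), finite_contractions _, fun w =>
    coact_mem_range_contractions M.isLeftCoaction x w w.2⟩,
    mem_contractions_coact M.isLeftCoaction x⟩

instance : Nonempty M.FinSub := ⟨(M.exists_mem_finSub 0).choose⟩

variable {M} in
/-- The inclusion between two finite-dimensional subcomodules. -/
def FinSub.mapIncl {W W' : M.FinSub} (h : W ≤ W') : W.comod ⟶ W'.comod where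
  toLin := Submodule.inclusion (show W.1 ≤ W'.1 from h)
  comm := by
    refine LinearMap.ext fun w => ?_
    apply Module.Flat.lTensor_preserves_injective_linearMap (M := B) W'.1.subtype
      W'.1.subtype_injective
    refine (LinearMap.congr_fun W'.incl.comm _).symm.trans ?_
    refine (LinearMap.congr_fun W.incl.comm w).trans ?_
    exact LinearMap.lTensor_comp_apply B W'.1.subtype
      (Submodule.inclusion (show W.1 ≤ W'.1 from h)) _

/-- The diagram of the finite-dimensional subcomodules. -/
def finSubDiagram : M.FinSub ⥤ LeftComod k B where
  obj W := W.comod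
  map f := FinSub.mapIncl (leOfHom f)

/-- The cocone of the finite-dimensional subcomodules with vertex the comodule itself. -/
def finSubCocone : Cocone M.finSubDiagram where
  pt := M
  ι :=
    { app := fun W => W.incl
      naturality := fun _ _ _ => rfl }

instance : ReflectsColimitsOfSize.{u, u} (forget k B) := by
  let _ : CreatesColimitsOfSize.{u, u} (forget k B) := comonadicCreatesColimits _
  infer_instance

/-- A comodule is the filtered colimit of its finite-dimensional subcomodules. -/
def finSubCoconeIsColimit : IsColimit M.finSubCocone := by
  -- Filtered colimits may be tested on vector spaces and then on sets, where the subcomodules need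
  -- only cover `M` and include injectively.
  refine isColimitOfReflects (forget k B) ?_
  have : PreservesFilteredColimits (CategoryTheory.forget (ModuleCat.{u} k)) := inferInstance
  have : ReflectsColimitsOfShape M.FinSub (CategoryTheory.forget (ModuleCat.{u} k)) :=
    reflectsColimitsOfShape_of_reflectsIsomorphisms
  refine isColimitOfReflects (CategoryTheory.forget (ModuleCat.{u} k)) ?_
  refine Types.FilteredColimit.isColimitOf' _ _ (fun x => ?_) fun W x y h => ?_
  · obtain ⟨W, hW⟩ := M.exists_mem_finSub x
    exact ⟨W, ⟨x, hW⟩, rfl⟩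
  · exact ⟨W, 𝟙 W, congrArg _ (W.1.subtype_injective h)⟩

/-- The underlying vector space of a tensor product. -/
def tensorRightForget (N : LeftComod k B) :
    forget k B ⋙ tensorRight N.V ≅ tensorRight N ⋙ forget k B :=
  NatIso.ofComponents (fun _ => Iso.refl _) fun _ => ModuleCat.MonoidalCategory.tensor_ext
    fun _ _ => rfl

instance (N : LeftComod k B) : PreservesColimitsOfSize.{u, u} (tensorRight N) where
  preservesColimitsOfShape {J} _ := by
    have : PreservesColimitsOfSize.{u, u} (forget k B) :=
      (forgetAdj k B).leftAdjoint_preservesColimits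
    have : PreservesColimitsOfShape J (tensorRight N.V) :=
      preservesColimitsOfShape_of_natIso (BraidedCategory.tensorLeftIsoTensorRight N.V)
    have : PreservesColimitsOfShape J (tensorRight N ⋙ forget k B) :=
      preservesColimitsOfShape_of_natIso (tensorRightForget N)
    exact preservesColimitsOfShape_of_reflects_of_preserves (tensorRight N) (forget k B)

/-- With `N` fixed, the structure morphisms form a natural transformation between functors
preserving filtered colimits, so invertibility at the finite-dimensional subcomodules of `M`
suffices. -/
theorem isStrong_of_isLeftRigid (h : IsLeftRigid (FinLeftComod k B))
    (F : LeftComod k B ⥤ LeftComod k B) [F.LaxLeftLinear (LeftComod k B)]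
    [PreservesFilteredColimits F] : IsStrong F := by
  intro M N
  let α : tensorRight (F.obj N) ⟶ tensorRight N ⋙ F :=
    { app := fun X => Functor.LaxLeftLinear.μₗ F X N
      naturality := fun _ _ f => Functor.LaxLeftLinear.μₗ_naturality_left F f N }
  have hα (W : M.FinSub) : IsIso (α.app (M.finSubDiagram.obj W)) := by
    obtain ⟨Y, ⟨p⟩⟩ := h ⟨W.comod, W.2.1⟩
    let _ := p
    let _ := exactPairingOfFin ⟨W.comod, W.2.1⟩ Y
    exact isIso_of_exactPairing F W.comod Y.obj N
  have : IsIso (Functor.whiskerLeft M.finSubDiagram α) := by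
    have (W : M.FinSub) : IsIso ((Functor.whiskerLeft M.finSubDiagram α).app W) := hα W
    exact NatIso.isIso_of_isIso_app _
  exact isIso_app_coconePt_of_preservesColimit _ α _ M.finSubCoconeIsColimit

end LeftComod

end FilteredColimit

end HopfTrimodule

end

/-! ### The theorem -/

theorem corollary9p45 :
    (∀ (C : Type u₁) [Category.{v₁} C] [MonoidalCategory C],
      HopfTrimodule.IsLeftClosed C →
      (∀ (F : C ⥤ C) [F.LaxLeftLinear C], HopfTrimodule.IsStrong F) →
      HopfTrimodule.IsLeftRigid C) ∧
    (∀ (k : Type u) [Field k] (B : Type u) [Ring B] [Bialgebra k B],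
      [ (HopfTrimodule.freeTrimod k B).IsEquivalence,
        HopfTrimodule.HasTwistedAntipode k B,
        HopfTrimodule.IsLeftRigid (HopfTrimodule.FinLeftComod k B),
        ∀ (F : HopfTrimodule.LeftComod k B ⥤ HopfTrimodule.LeftComod k B)
          [F.LaxLeftLinear (HopfTrimodule.LeftComod k B)],
          PreservesFiniteLimits F → PreservesFilteredColimits F →
            HopfTrimodule.IsStrong F ].TFAE) := by
  refine ⟨fun C _ _ hC h => HopfTrimodule.isLeftRigid_of_isLeftClosed hC h, fun k _ B _ _ => ?_⟩
  tfae_have 1 → 2 := HopfTrimodule.hasTwistedAntipode_of_isEquivalence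
  tfae_have 2 → 1 := HopfTrimodule.isEquivalence_of_hasTwistedAntipode
  tfae_have 2 → 3 := HopfTrimodule.LeftComod.isLeftRigid_of_hasTwistedAntipode
  tfae_have 3 → 4 := fun h F _ _ _ => HopfTrimodule.LeftComod.isStrong_of_isLeftRigid h F
  tfae_have 4 → 2 := fun h => HopfTrimodule.hasTwistedAntipode_of_bijective
    (HopfTrimodule.LeftComod.bijective_galois_of_isStrong
      (h (HopfTrimodule.LeftComod.cofreeEndo k B) inferInstance inferInstance))
  tfae_finish
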